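/- Let $\mathbb{S}^1=\mathbb{R}/2\pi\mathbb{Z}$ be the circle with angular coordinate $\beta$ and its standard Riemannian metric, let $\Omega=\mathbb{R}\times\mathbb{S}^1$ with points $(t,x)$ and Laplacian $\Delta=\partial_t^2+\partial_\beta^2$ (as a self-adjoint operator on $L^2(\Omega)$), and put $\Lambda=(1-\Delta)^{-1/2}$. Let $\mathcal{A}^\dagger$ be the $C^*$-algebra of bounded operators on $L^2(\Omega)$ generated by the multiplications $a(M_x)$, $(a(M_x)u)(t,x)=a(x)u(t,x)$, with $a\in C^\infty(\mathbb{S}^1)$, and by the operators $\Lambda$, $\frac1i\frac{\partial}{\partial t}\Lambda$ and $\frac1i\frac{\partial}{\partial\beta}\Lambda$. Let $\mathcal{A}^\diamond$ be the $C^*$-algebra generated by $\mathcal{A}^\dagger$ and the multiplications $e^{ijM_t}$, $(e^{ijM_t}u)(t,x)=e^{ijt}u(t,x)$, $j\in\mathbb{Z}$. For a $C^*$-algebra $A$ with commutator ideal $I$ (the closed two-sided ideal generated by all $ab-ba$, $a,b\in A$), the symbol space of $A$ is the maximal ideal space $M_A$ (space of characters) of the commutative algebra $A/I$, and the symbol map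 $\sigma:A\to C(M_A)$ is the quotient map $A\to A/I$ followed by the Gelfand transform. Write $\mathbf{M}^\dagger,\sigma^\dagger$ and $\mathbf{M}^\diamond,\sigma^\diamond$ for the symbol spaces and symbol maps of $\mathcal{A}^\dagger$ and $\mathcal{A}^\diamond$. Let $S^1=\{z\in\mathbb{C}:|z|=1\}$, and let $S^1_\infty=\{w=\tau+i\xi\in\mathbb{C}: \tau^2+\xi^2=1\}$ be the circle at infinity of the dual variables of $(t,\beta)$. There is a homeomorphism $\mathbf{M}^\dagger\cong\mathbb{S}^1\times S^1_\infty$ under which, for all $a \in C^\infty(\mathbb{S}^1)$ and all $(x,w)$ with $w=\tau+i\xi$, $$\sigma^\dagger_{a(M_x)}(x,w)=a(x),\qquad \sigma^\dagger_{\Lambda}(x,w)=0,\qquad \sigma^\dagger_{\frac1i\partial_t\Lambda}(x,w)=\tau,\qquad \sigma^\dagger_{\frac1i\partial_\beta\Lambda}(x,w)=\xi .$$ With $\mathbf{M}^\dagger$ identified with $\mathbb{S}^1\times S^1_\infty$ in this way, $\mathbf{M}^\diamond$ is homeomorphic to $S^1\times\mathbb{S}^1\times S^1_\infty$ by a homeomorphism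 under which the symbol map $\sigma^\diamond:\mathcal{A}^\diamond\to C(S^1\times\mathbb{S}^1\times S^1_\infty)$ is given by $$\sigma^\diamond_A(e^{i\theta},x,w)=\sigma^\dagger_A(x,w)\quad(A\in\mathcal{A}^\dagger),\qquad \sigma^\diamond_{e^{ijM_t}}(e^{i\theta},x,w)=e^{ij\theta}\quad(j\in\mathbb{Z}).$$ -/

import Mathlib

open MeasureTheory Filter Topology WeakDual
open scoped ContDiff BoundedContinuousFunction InnerProductSpace

noncomputable section

namespace CylinderAlgebra

/-! ## Symbol space and symbol map of an algebra -/

section Symbol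

variable (A : Type*) [NormedRing A]

/-- The commutator ideal: the closed two-sided ideal generated by all `a * b - b * a`. -/
def commutatorIdeal : Ideal A :=
  (TwoSidedIdeal.asIdeal
    (TwoSidedIdeal.span {c : A | ∃ a b : A, c = a * b - b * a})).closure

instance : (commutatorIdeal A).IsTwoSided where
  mul_mem_of_left := by
    intro a b ha
    exact map_mem_closure (f := fun y : A => y * b) (continuous_mul_const b) ha
      fun _ hx => Ideal.mul_mem_right b _ hx

/-- The quotient of an algebra by its commutator ideal. -/
abbrev CommQuotient : Type _ := A ⧸ commutatorIdeal A

instance : TopologicalSpace (CommQuotient A) := instTopologicalSpaceQuotient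

theorem commQuotient_mul_comm (p q : CommQuotient A) : p * q = q * p := by
  obtain ⟨a, rfl⟩ := Ideal.Quotient.mk_surjective p
  obtain ⟨b, rfl⟩ := Ideal.Quotient.mk_surjective q
  rw [← map_mul, ← map_mul, Ideal.Quotient.eq]
  exact subset_closure (TwoSidedIdeal.subset_span ⟨a, b, rfl⟩)

variable [NormedAlgebra ℂ A]

/-- The symbol space: the maximal ideal space of the quotient by the commutator ideal, that is,
its space of characters (nonzero multiplicative functionals) with the Gelfand topology. -/
abbrev SymbolSpace : Type _ := characterSpace ℂ (CommQuotient A)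

/-- The symbol map: the quotient map followed by the Gelfand transform. -/
def symbol : A →ₐ[ℂ] C(SymbolSpace A, ℂ) :=
  (gelfandTransform ℂ (CommQuotient A)).comp (Ideal.Quotient.mkₐ ℂ (commutatorIdeal A))

end Symbol

/-! ## The Hilbert space `L²(ℝ × 𝕊¹)` -/

instance factTwoPiPos : Fact (0 < 2 * Real.pi) := ⟨Real.two_pi_pos⟩

/-- The circle `𝕊¹`, as `ℝ / 2πℤ` with its arc length measure (total length `2π`). -/
abbrev S1 : Type := AddCircle (2 * Real.pi)

/-- The cylinder `Ω = ℝ × 𝕊¹`; `volume` is the product measure `dt dβ`. -/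
abbrev Cyl : Type := ℝ × S1

/-- `L²(Ω)`. -/
abbrev HΩ : Type := Lp ℂ 2 (volume : Measure Cyl)

theorem memLp_mul (f : Cyl →ᵇ ℂ) (u : HΩ) :
    MemLp (fun z => f z * u z) 2 (volume : Measure Cyl) :=
  (Lp.memLp u).of_le_mul (c := ‖f‖)
    (f.continuous.aestronglyMeasurable.mul (Lp.aestronglyMeasurable u))
    (Eventually.of_forall fun z => by
      change ‖f z * u z‖ ≤ _
      rw [norm_mul]
      exact mul_le_mul_of_nonneg_right (f.norm_coe_le_norm z) (norm_nonneg _))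

/-- Multiplication by a bounded continuous function, as an operator on `L²(Ω)`. -/
def mulOp (f : Cyl →ᵇ ℂ) : HΩ →L[ℂ] HΩ :=
  LinearMap.mkContinuous
    { toFun := fun u => MemLp.toLp (fun z => f z * u z) (memLp_mul f u)
      map_add' := fun u v => by
        rw [← MemLp.toLp_add]
        refine MemLp.toLp_congr _ _ ?_
        filter_upwards [Lp.coeFn_add u v] with z hz
        simp only [hz, Pi.add_apply, mul_add]
      map_smul' := fun c u => by
        rw [RingHom.id_apply, ← MemLp.toLp_const_smul]
        refine MemLp.toLp_congr _ _ ?_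
        filter_upwards [Lp.coeFn_smul c u] with z hz
        simp only [hz, Pi.smul_apply, smul_eq_mul, mul_left_comm] }
    ‖f‖ (fun u => Lp.norm_le_mul_norm_of_ae_le_mul (by
      filter_upwards [MemLp.coeFn_toLp (memLp_mul f u)] with z hz
      simp only [LinearMap.coe_mk, AddHom.coe_mk]
      rw [hz, norm_mul]
      exact mul_le_mul_of_nonneg_right (f.norm_coe_le_norm z) (norm_nonneg _)))

theorem coeFn_mulOp (f : Cyl →ᵇ ℂ) (u : HΩ) :
    mulOp f u =ᵐ[volume] fun z => f z * u z :=
  MemLp.coeFn_toLp (memLp_mul f u)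

/-- The function `(t, x) ↦ a x` on the cylinder. -/
def liftX (a : C(S1, ℂ)) : Cyl →ᵇ ℂ :=
  (BoundedContinuousFunction.mkOfCompact a).compContinuous ⟨Prod.snd, continuous_snd⟩

/-- The function `(t, x) ↦ e^{ijt}` on the cylinder. -/
def expT (j : ℤ) : Cyl →ᵇ ℂ :=
  BoundedContinuousFunction.ofNormedAddCommGroup
    (fun z : Cyl => Complex.exp (Complex.I * j * z.1)) (by fun_prop) 1
    (fun z => by simp [Complex.norm_exp])

/-! ## Weak derivatives and the Sobolev space `H¹(Ω)` -/

/-- Test functions on the cylinder: smooth (read through `ℝ × ℝ → ℝ × 𝕊¹`), compact support. -/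
structure IsTest (φ : Cyl → ℂ) : Prop where
  smooth : ContDiff ℝ ∞ (fun p : ℝ × ℝ => φ (p.1, (p.2 : S1)))
  compact : HasCompactSupport φ

/-- Classical derivative in the direction of `ℝ`. -/
def dt (φ : Cyl → ℂ) (z : Cyl) : ℂ := deriv (fun s : ℝ => φ (z.1 + s, z.2)) 0

/-- Classical derivative in the direction of `𝕊¹` (with respect to the angle `β`). -/
def dx (φ : Cyl → ℂ) (z : Cyl) : ℂ := deriv (fun s : ℝ => φ (z.1, z.2 + (s : S1))) 0

/-- `v` is the weak derivative `∂u/∂t`. -/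
def IsWeakDt (u v : HΩ) : Prop :=
  ∀ φ : Cyl → ℂ, IsTest φ → ∫ z, u z * dt φ z = -∫ z, v z * φ z

/-- `v` is the weak derivative `∂u/∂β`. -/
def IsWeakDx (u v : HΩ) : Prop :=
  ∀ φ : Cyl → ℂ, IsTest φ → ∫ z, u z * dx φ z = -∫ z, v z * φ z

theorem isOpenQuotientMap_cover :
    IsOpenQuotientMap (fun p : ℝ × ℝ => ((p.1, (p.2 : S1)) : Cyl)) := by
  have h : IsOpenQuotientMap (fun b : ℝ => (b : S1)) :=
    QuotientAddGroup.isOpenQuotientMap_mk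
  exact IsOpenQuotientMap.id.prodMap h

theorem IsTest.continuous {φ : Cyl → ℂ} (h : IsTest φ) : Continuous φ :=
  isOpenQuotientMap_cover.isQuotientMap.continuous_iff.2 h.smooth.continuous

theorem dt_cover {φ : Cyl → ℂ} (h : IsTest φ) (p : ℝ × ℝ) :
    dt φ (p.1, (p.2 : S1)) =
      fderiv ℝ (fun p : ℝ × ℝ => φ (p.1, (p.2 : S1))) p (1, 0) := by
  have hd : HasDerivAt (fun s : ℝ => p + s • ((1 : ℝ), (0 : ℝ))) (1, 0) 0 := by
    simpa using ((hasDerivAt_id (0 : ℝ)).smul_const ((1 : ℝ), (0 : ℝ))).const_add p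
  have hf := (h.smooth.differentiable (by simp) (p + (0 : ℝ) • ((1 : ℝ), (0 : ℝ)))).hasFDerivAt
  have := (hf.comp_hasDerivAt (0 : ℝ) hd).deriv
  simpa [dt, Function.comp_def] using this

theorem dx_cover {φ : Cyl → ℂ} (h : IsTest φ) (p : ℝ × ℝ) :
    dx φ (p.1, (p.2 : S1)) =
      fderiv ℝ (fun p : ℝ × ℝ => φ (p.1, (p.2 : S1))) p (0, 1) := by
  have hd : HasDerivAt (fun s : ℝ => p + s • ((0 : ℝ), (1 : ℝ))) (0, 1) 0 := by
    simpa using ((hasDerivAt_id (0 : ℝ)).smul_const ((0 : ℝ), (1 : ℝ))).const_add p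
  have hf := (h.smooth.differentiable (by simp) (p + (0 : ℝ) • ((0 : ℝ), (1 : ℝ)))).hasFDerivAt
  have := (hf.comp_hasDerivAt (0 : ℝ) hd).deriv
  simpa [dx, Function.comp_def] using this

theorem IsTest.continuous_dt {φ : Cyl → ℂ} (h : IsTest φ) : Continuous (dt φ) := by
  refine isOpenQuotientMap_cover.isQuotientMap.continuous_iff.2 ?_
  have : (dt φ ∘ fun p : ℝ × ℝ => ((p.1, (p.2 : S1)) : Cyl)) =
      fun p => fderiv ℝ (fun p : ℝ × ℝ => φ (p.1, (p.2 : S1))) p (1, 0) :=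
    funext fun p => dt_cover h p
  rw [this]
  exact (h.smooth.continuous_fderiv (by simp)).clm_apply continuous_const

theorem IsTest.continuous_dx {φ : Cyl → ℂ} (h : IsTest φ) : Continuous (dx φ) := by
  refine isOpenQuotientMap_cover.isQuotientMap.continuous_iff.2 ?_
  have : (dx φ ∘ fun p : ℝ × ℝ => ((p.1, (p.2 : S1)) : Cyl)) =
      fun p => fderiv ℝ (fun p : ℝ × ℝ => φ (p.1, (p.2 : S1))) p (0, 1) :=
    funext fun p => dx_cover h p
  rw [this]
  exact (h.smooth.continuous_fderiv (by simp)).clm_apply continuous_const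

theorem IsTest.compact_dt {φ : Cyl → ℂ} (h : IsTest φ) : HasCompactSupport (dt φ) := by
  refine h.compact.mono' fun z hz => ?_
  by_contra hn
  refine hz ?_
  have h0 : φ =ᶠ[𝓝 z] 0 := notMem_tsupport_iff_eventuallyEq.1 hn
  have hc : Tendsto (fun s : ℝ => ((z.1 + s, z.2) : Cyl)) (𝓝 0) (𝓝 z) := by
    have : Continuous (fun s : ℝ => ((z.1 + s, z.2) : Cyl)) := by fun_prop
    simpa using this.tendsto 0
  have : (fun s : ℝ => φ (z.1 + s, z.2)) =ᶠ[𝓝 0] fun _ => 0 := hc.eventually h0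
  simp [dt, this.deriv_eq]

theorem IsTest.compact_dx {φ : Cyl → ℂ} (h : IsTest φ) : HasCompactSupport (dx φ) := by
  refine h.compact.mono' fun z hz => ?_
  by_contra hn
  refine hz ?_
  have h0 : φ =ᶠ[𝓝 z] 0 := notMem_tsupport_iff_eventuallyEq.1 hn
  have hc : Tendsto (fun s : ℝ => ((z.1, z.2 + (s : S1)) : Cyl)) (𝓝 0) (𝓝 z) := by
    have h1 : Continuous (fun s : ℝ => (s : S1)) := AddCircle.continuous_mk' _
    have : Continuous (fun s : ℝ => ((z.1, z.2 + (s : S1)) : Cyl)) := by fun_prop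
    simpa using this.tendsto 0
  have : (fun s : ℝ => φ (z.1, z.2 + (s : S1))) =ᶠ[𝓝 0] fun _ => 0 := hc.eventually h0
  simp [dx, this.deriv_eq]

theorem exists_pairing {ψ : Cyl → ℂ} (hc : Continuous ψ) (hs : HasCompactSupport ψ) :
    ∃ ℓ : HΩ →L[ℂ] ℂ, ∀ u : HΩ, ℓ u = ∫ z, u z * ψ z := by
  have hm : MemLp (fun z => star (ψ z)) 2 (volume : Measure Cyl) :=
    (hc.memLp_of_hasCompactSupport hs).star
  refine ⟨innerSL ℂ (hm.toLp _), fun u => ?_⟩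
  rw [innerSL_apply_apply, L2.inner_def]
  refine integral_congr_ae ?_
  filter_upwards [hm.coeFn_toLp] with z hz
  rw [RCLike.inner_apply, hz, starRingEnd_apply, star_star]

/-- The Hilbert space `H¹(Ω)`: the triples `(u, ∂u/∂t, ∂u/∂β)` in `L²(Ω)³`, with
`‖u‖² + ‖∂u/∂t‖² + ‖∂u/∂β‖²` as the square of the norm. -/
def Sobolev : Submodule ℂ (PiLp 2 fun _ : Fin 3 => HΩ) where
  carrier := {F | IsWeakDt (F 0) (F 1) ∧ IsWeakDx (F 0) (F 2)}
  zero_mem' := by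
    constructor
    · intro φ h
      obtain ⟨ℓ, hℓ⟩ := exists_pairing h.continuous_dt h.compact_dt
      obtain ⟨m, hm⟩ := exists_pairing h.continuous h.compact
      rw [← hℓ, ← hm]; simp
    · intro φ h
      obtain ⟨ℓ, hℓ⟩ := exists_pairing h.continuous_dx h.compact_dx
      obtain ⟨m, hm⟩ := exists_pairing h.continuous h.compact
      rw [← hℓ, ← hm]; simp
  add_mem' := by
    rintro F G ⟨hF, hF'⟩ ⟨hG, hG'⟩
    constructor
    · intro φ h
      have h1 := hF φ h
      have h2 := hG φ h
      obtain ⟨ℓ, hℓ⟩ := exists_pairing h.continuous_dt h.compact_dt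
      obtain ⟨m, hm⟩ := exists_pairing h.continuous h.compact
      rw [← hℓ, ← hm] at h1 h2 ⊢
      rw [PiLp.add_apply, PiLp.add_apply, map_add, map_add, h1, h2, neg_add]
    · intro φ h
      have h1 := hF' φ h
      have h2 := hG' φ h
      obtain ⟨ℓ, hℓ⟩ := exists_pairing h.continuous_dx h.compact_dx
      obtain ⟨m, hm⟩ := exists_pairing h.continuous h.compact
      rw [← hℓ, ← hm] at h1 h2 ⊢
      rw [PiLp.add_apply, PiLp.add_apply, map_add, map_add, h1, h2, neg_add]
  smul_mem' := by
    rintro c F ⟨hF, hF'⟩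
    constructor
    · intro φ h
      have h1 := hF φ h
      obtain ⟨ℓ, hℓ⟩ := exists_pairing h.continuous_dt h.compact_dt
      obtain ⟨m, hm⟩ := exists_pairing h.continuous h.compact
      rw [← hℓ, ← hm] at h1 ⊢
      rw [PiLp.smul_apply, PiLp.smul_apply, map_smul, map_smul, h1, smul_neg]
    · intro φ h
      have h1 := hF' φ h
      obtain ⟨ℓ, hℓ⟩ := exists_pairing h.continuous_dx h.compact_dx
      obtain ⟨m, hm⟩ := exists_pairing h.continuous h.compact
      rw [← hℓ, ← hm] at h1 ⊢
      rw [PiLp.smul_apply, PiLp.smul_apply, map_smul, map_smul, h1, smul_neg]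

theorem isClosed_sobolev : IsClosed (Sobolev : Set (PiLp 2 fun _ : Fin 3 => HΩ)) := by
  have hp : ∀ i : Fin 3, Continuous fun F : PiLp 2 fun _ : Fin 3 => HΩ => F i :=
    fun i => (PiLp.proj (𝕜 := ℂ) 2 (fun _ : Fin 3 => HΩ) i).continuous
  have h : (Sobolev : Set (PiLp 2 fun _ : Fin 3 => HΩ)) =
      {F | ∀ φ : Cyl → ℂ, IsTest φ → ∫ z, F 0 z * dt φ z = -∫ z, F 1 z * φ z} ∩
      {F | ∀ φ : Cyl → ℂ, IsTest φ → ∫ z, F 0 z * dx φ z = -∫ z, F 2 z * φ z} := rfl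
  rw [h]
  refine IsClosed.inter ?_ ?_
  · simp only [Set.ofPred_forall]
    refine isClosed_iInter fun φ => isClosed_iInter fun hφ => ?_
    obtain ⟨ℓ, hℓ⟩ := exists_pairing hφ.continuous_dt hφ.compact_dt
    obtain ⟨m, hm⟩ := exists_pairing hφ.continuous hφ.compact
    simp only [← hℓ, ← hm]
    exact isClosed_eq (ℓ.continuous.comp (hp 0)) (m.continuous.comp (hp 1)).neg
  · simp only [Set.ofPred_forall]
    refine isClosed_iInter fun φ => isClosed_iInter fun hφ => ?_
    obtain ⟨ℓ, hℓ⟩ := exists_pairing hφ.continuous_dx hφ.compact_dx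
    obtain ⟨m, hm⟩ := exists_pairing hφ.continuous hφ.compact
    simp only [← hℓ, ← hm]
    exact isClosed_eq (ℓ.continuous.comp (hp 0)) (m.continuous.comp (hp 2)).neg

instance : CompleteSpace Sobolev := isClosed_sobolev.completeSpace_coe

/-- The inclusion `H¹(Ω) → L²(Ω)`, `(u, ∂u/∂t, ∂u/∂β) ↦ u`. -/
def incl : Sobolev →L[ℂ] HΩ := (PiLp.proj 2 (fun _ : Fin 3 => HΩ) 0).comp Sobolev.subtypeL

/-- The operator `∂/∂t : H¹(Ω) → L²(Ω)`. -/
def gradT : Sobolev →L[ℂ] HΩ := (PiLp.proj 2 (fun _ : Fin 3 => HΩ) 1).comp Sobolev.subtypeL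

/-- The operator `∂/∂β : H¹(Ω) → L²(Ω)`. -/
def gradX : Sobolev →L[ℂ] HΩ := (PiLp.proj 2 (fun _ : Fin 3 => HΩ) 2).comp Sobolev.subtypeL

/-! ## `(1 - Δ)^{-1/2}` and its derivatives -/

/-- `(1 - Δ)⁻¹`, for the self-adjoint Laplacian defined by the form `∫ ∇u · ∇v̄` on `H¹(Ω)`:
by `inner_resolventLap`, `u = resolventLap f` is the element of `H¹(Ω)` with
`∫ u v̄ + ∫ ∇u · ∇v̄ = ∫ f v̄` for all `v ∈ H¹(Ω)`. -/
def resolventLap : HΩ →L[ℂ] HΩ := incl ∘L ContinuousLinearMap.adjoint incl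

theorem inner_resolventLap (f : HΩ) : ∃ U : Sobolev, incl U = resolventLap f ∧ ∀ V : Sobolev,
    ⟪incl V, incl U⟫_ℂ + ⟪gradT V, gradT U⟫_ℂ + ⟪gradX V, gradX U⟫_ℂ = ⟪incl V, f⟫_ℂ := by
  refine ⟨ContinuousLinearMap.adjoint incl f, rfl, fun V => ?_⟩
  rw [← ContinuousLinearMap.adjoint_inner_right incl V f, Submodule.coe_inner, PiLp.inner_apply,
    Fin.sum_univ_three]
  rfl

theorem resolventLap_nonneg : 0 ≤ resolventLap := by
  rw [ContinuousLinearMap.nonneg_iff_isPositive]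
  exact ContinuousLinearMap.isPositive_self_comp_adjoint incl

/-- The positive square root of a positive bounded operator (continuous functional calculus). -/
def sqrtOp {E : Type*} [NormedAddCommGroup E] [InnerProductSpace ℂ E] [CompleteSpace E]
    (T : E →L[ℂ] E) : E →L[ℂ] E := CFC.sqrt T

theorem sqrtOp_nonneg {E : Type*} [NormedAddCommGroup E] [InnerProductSpace ℂ E]
    [CompleteSpace E] (T : E →L[ℂ] E) : 0 ≤ sqrtOp T := CFC.sqrt_nonneg _

theorem sqrtOp_mul_self {E : Type*} [NormedAddCommGroup E] [InnerProductSpace ℂ E]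
    [CompleteSpace E] {T : E →L[ℂ] E} (hT : 0 ≤ T) : sqrtOp T * sqrtOp T = T :=
  CFC.sqrt_mul_sqrt_self _ hT

/-- `Λ = (1 - Δ)^{-1/2}`, the positive square root of `(1 - Δ)⁻¹`. -/
def bessel : HΩ →L[ℂ] HΩ := sqrtOp resolventLap

theorem bessel_nonneg : 0 ≤ bessel := sqrtOp_nonneg _

theorem bessel_mul_self : bessel * bessel = resolventLap := sqrtOp_mul_self resolventLap_nonneg

theorem norm_adjoint_incl (f : HΩ) : ‖ContinuousLinearMap.adjoint incl f‖ = ‖bessel f‖ := by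
  have h1 : ⟪f, resolventLap f⟫_ℂ = (‖ContinuousLinearMap.adjoint incl f‖ ^ 2 : ℝ) := by
    rw [resolventLap, ContinuousLinearMap.comp_apply, ← ContinuousLinearMap.adjoint_inner_left,
      inner_self_eq_norm_sq_to_K]
    norm_cast
  have hsa : ContinuousLinearMap.adjoint bessel = bessel :=
    (IsSelfAdjoint.of_nonneg bessel_nonneg).adjoint_eq
  have h2 : ⟪f, resolventLap f⟫_ℂ = (‖bessel f‖ ^ 2 : ℝ) := by
    rw [← bessel_mul_self, mul_apply_eq_comp,
      ← ContinuousLinearMap.adjoint_inner_left, hsa, inner_self_eq_norm_sq_to_K]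
    norm_cast
  have h3 : ‖ContinuousLinearMap.adjoint incl f‖ ^ 2 = ‖bessel f‖ ^ 2 := by
    exact_mod_cast h1.symm.trans h2
  exact (sq_eq_sq₀ (norm_nonneg _) (norm_nonneg _)).1 h3

/-- `Λ` maps `L²(Ω)` boundedly into `H¹(Ω)`. -/
theorem exists_besselLift : ∃ V : HΩ →L[ℂ] Sobolev, incl ∘L V = bessel := by
  let K : Submodule ℂ HΩ := bessel.range.topologicalClosure
  let e : HΩ →ₗ[ℂ] K := bessel.toLinearMap.codRestrict K
    fun f => Submodule.le_topologicalClosure _ ⟨f, rfl⟩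
  have he : DenseRange e := by
    intro y
    rw [closure_subtype]
    have : ((↑) '' Set.range e : Set HΩ) = Set.range bessel := by
      rw [← Set.range_comp]; rfl
    rw [this]
    exact y.2
  have hn : ∀ f : HΩ, ‖(ContinuousLinearMap.adjoint incl).toLinearMap f‖ ≤ 1 * ‖e f‖ := by
    intro f
    rw [one_mul]
    exact (norm_adjoint_incl f).le
  let W : K →L[ℂ] Sobolev := (ContinuousLinearMap.adjoint incl).toLinearMap.extendOfNorm e
  have hW : ∀ f, W (e f) = ContinuousLinearMap.adjoint incl f :=
    fun f => LinearMap.extendOfNorm_eq he ⟨1, hn⟩ f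
  have hKc : IsClosed (K : Set HΩ) := Submodule.isClosed_topologicalClosure _
  have : CompleteSpace K := hKc.completeSpace_coe
  have hsa : ContinuousLinearMap.adjoint bessel = bessel :=
    (IsSelfAdjoint.of_nonneg bessel_nonneg).adjoint_eq
  have hWK : ∀ y : K, incl (W y) = bessel y := by
    have hc : incl ∘ W = fun y : K => bessel y := by
      refine he.equalizer (incl.continuous.comp W.continuous)
        (bessel.continuous.comp continuous_subtype_val) (funext fun f => ?_)
      simp only [Function.comp_apply, hW]
      change resolventLap f = bessel (bessel f)
      rw [← bessel_mul_self]; rfl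
    exact fun y => congrFun hc y
  refine ⟨W ∘L K.orthogonalProjectionOnto, ContinuousLinearMap.ext fun f => ?_⟩
  simp only [ContinuousLinearMap.comp_apply]
  rw [hWK, ← sub_eq_zero, ← map_sub, ← inner_self_eq_zero (𝕜 := ℂ),
    ← ContinuousLinearMap.adjoint_inner_right, hsa, ← neg_sub, inner_neg_left, neg_eq_zero]
  exact Submodule.starProjection_inner_eq_zero f _
    (Submodule.le_topologicalClosure _ ⟨_, rfl⟩)

/-- `Λ` as an operator `L²(Ω) → H¹(Ω)`. -/
def besselLift : HΩ →L[ℂ] Sobolev := exists_besselLift.choose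

theorem incl_besselLift (f : HΩ) : incl (besselLift f) = bessel f :=
  congrArg (fun T : HΩ →L[ℂ] HΩ => T f) exists_besselLift.choose_spec

/-- The operator `(1/i) (∂/∂t) Λ`. -/
def DtBessel : HΩ →L[ℂ] HΩ := (1 / Complex.I) • (gradT ∘L besselLift)

/-- The operator `(1/i) (∂/∂β) Λ`. -/
def DxBessel : HΩ →L[ℂ] HΩ := (1 / Complex.I) • (gradX ∘L besselLift)

theorem isWeakDt_bessel (f : HΩ) : IsWeakDt (bessel f) (Complex.I • DtBessel f) := by
  have h := (besselLift f).2.1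
  have h0 : (besselLift f : PiLp 2 fun _ : Fin 3 => HΩ) 0 = bessel f := incl_besselLift f
  have h1 : (besselLift f : PiLp 2 fun _ : Fin 3 => HΩ) 1 = Complex.I • DtBessel f := by
    rw [DtBessel, smul_apply, smul_smul, mul_one_div_cancel Complex.I_ne_zero,
      one_smul]
    rfl
  rwa [h0, h1] at h

theorem isWeakDx_bessel (f : HΩ) : IsWeakDx (bessel f) (Complex.I • DxBessel f) := by
  have h := (besselLift f).2.2
  have h0 : (besselLift f : PiLp 2 fun _ : Fin 3 => HΩ) 0 = bessel f := incl_besselLift f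
  have h1 : (besselLift f : PiLp 2 fun _ : Fin 3 => HΩ) 2 = Complex.I • DxBessel f := by
    rw [DxBessel, smul_apply, smul_smul, mul_one_div_cancel Complex.I_ne_zero,
      one_smul]
    rfl
  rwa [h0, h1] at h

/-! ## The algebras `𝒜†` and `𝒜◇` -/

/-- `a ∈ C^∞(𝕊¹)`. -/
def SmoothS1 (a : C(S1, ℂ)) : Prop := ContDiff ℝ ∞ fun b : ℝ => a (b : S1)

/-- The generators of `𝒜†`. -/
def gensDagger : Set (HΩ →L[ℂ] HΩ) :=
  {T | ∃ a : C(S1, ℂ), SmoothS1 a ∧ T = mulOp (liftX a)} ∪ {bessel, DtBessel, DxBessel}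

/-- The C*-algebra `𝒜†`: the smallest closed star-subalgebra of the bounded operators on `L²(Ω)`
that contains the generators (it contains the identity, which is multiplication by `a = 1`). -/
def ADagger : StarSubalgebra ℂ (HΩ →L[ℂ] HΩ) :=
  (StarAlgebra.adjoin ℂ gensDagger).topologicalClosure

/-- The C*-algebra `𝒜◇`, generated by `𝒜†` and the multiplications by `e^{ijt}`, `j ∈ ℤ`. -/
def ADiamond : StarSubalgebra ℂ (HΩ →L[ℂ] HΩ) :=
  (StarAlgebra.adjoin ℂ
    ((ADagger : Set (HΩ →L[ℂ] HΩ)) ∪ Set.range fun j : ℤ => mulOp (expT j))).topologicalClosure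

theorem gensDagger_subset : gensDagger ⊆ (ADagger : Set (HΩ →L[ℂ] HΩ)) :=
  (StarAlgebra.subset_adjoin ℂ _).trans (StarSubalgebra.le_topologicalClosure _)

theorem aDagger_le_aDiamond : ADagger ≤ ADiamond := fun _ hT =>
  StarSubalgebra.le_topologicalClosure _ (StarAlgebra.subset_adjoin ℂ _ (Or.inl hT))

/-- The inclusion `𝒜† → 𝒜◇`. -/
def toDiamond (T : ADagger) : ADiamond := ⟨T, aDagger_le_aDiamond T.2⟩

/-- `a(M_x)` as an element of `𝒜†`. -/
def mulX (a : C(S1, ℂ)) (ha : SmoothS1 a) : ADagger :=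
  ⟨mulOp (liftX a), gensDagger_subset (Or.inl ⟨a, ha, rfl⟩)⟩

/-- `Λ` as an element of `𝒜†`. -/
def genΛ : ADagger := ⟨bessel, gensDagger_subset (Or.inr (by simp))⟩

/-- `(1/i) (∂/∂t) Λ` as an element of `𝒜†`. -/
def genDt : ADagger := ⟨DtBessel, gensDagger_subset (Or.inr (by simp))⟩

/-- `(1/i) (∂/∂β) Λ` as an element of `𝒜†`. -/
def genDx : ADagger := ⟨DxBessel, gensDagger_subset (Or.inr (by simp))⟩

/-- `e^{ijM_t}` as an element of `𝒜◇`. -/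
def mulExp (j : ℤ) : ADiamond :=
  ⟨mulOp (expT j),
    StarSubalgebra.le_topologicalClosure _ (StarAlgebra.subset_adjoin ℂ _ (Or.inr ⟨j, rfl⟩))⟩

end CylinderAlgebra

end

noncomputable section

namespace CylinderAlgebra

/-! ## Density of the test functions in `L²(Ω)` -/

/-! A character kills commutators and is continuous, so it factors through the quotient by the
commutator ideal: each symbol space is the space of all characters of the algebra
(`symbolSpaceHomeomorph`). It remains to find the characters.

Characters of a C*-algebra preserve the star, hence are determined by their values on the
generators. The unitary `e^{iβ}` goes to a number of modulus one, which is a base point on the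
circle. Conjugating `(1 - Δ)⁻¹` by `e^{inβ}` changes it by terms of lower order
(`planeWave_resolventLap`), and a character turns this relation into the vanishing of the value of
`Λ` (`character_genΛ`). The identity `Λ² + (DₜΛ)² + (D_βΛ)² = 1` (`bessel_sq_add`) then puts the
values of the two self-adjoint operators `DₜΛ`, `D_βΛ` on a unit circle. In `𝒜◇` the unitary
`e^{it}` adds one more point of the circle. This gives injective continuous maps into the asserted
spaces.

Surjectivity comes from wave packets `u n` concentrating at a point of the cylinder while
oscillating at frequency `N (τ, ξ)`, `N → ∞` (`exists_wavePackets`). They are approximate joint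
eigenvectors of all generators. The operators with this property form a closed star-subalgebra, on
which the approximate eigenvalue is a character (`exists_algHom_of_approxEigen`). Every character of
`𝒜†` that is needed is the restriction of one of `𝒜◇`. Continuous bijections from compact spaces to
Hausdorff spaces are homeomorphisms.

No Fourier transform is used: `Λ` enters only through the form on `H¹(Ω)` and positivity. The
analytic input is that weak derivatives are weak derivatives of the translation group
(`WeakDeriv.hasDerivAt_inner_shift`), that `besselLift` is an isometry (`norm_besselLift`), and the
inequality `mul_norm_bessel_sub_le`. -/

theorem IsTest.memLp {φ : Cyl → ℂ} (h : IsTest φ) : MemLp φ 2 (volume : Measure Cyl) :=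
  h.continuous.memLp_of_hasCompactSupport h.compact

/-- A test function as an element of `L²(Ω)`. -/
def IsTest.toL2 {φ : Cyl → ℂ} (h : IsTest φ) : HΩ := h.memLp.toLp φ

theorem IsTest.coeFn_toL2 {φ : Cyl → ℂ} (h : IsTest φ) : h.toL2 =ᵐ[volume] φ :=
  h.memLp.coeFn_toLp

theorem dist_cover_le (p q : ℝ × ℝ) :
    dist ((p.1, (p.2 : S1)) : Cyl) (q.1, (q.2 : S1)) ≤ dist p q := by
  rw [Prod.dist_eq, Prod.dist_eq]
  refine max_le_max le_rfl ?_
  rw [dist_eq_norm, dist_eq_norm, ← AddCircle.coe_sub]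
  exact QuotientAddGroup.norm_mk_le_norm

/-- Mollification with a kernel on the cover `ℝ × ℝ`: translating the argument on the cylinder keeps
the result periodic, and read on the cover it is an ordinary convolution. -/
theorem exists_isTest_near {g : Cyl → ℂ} (hg : Continuous g) {R : ℝ}
    (hR : ∀ z : Cyl, g z ≠ 0 → |z.1| ≤ R) {δ : ℝ} (hδ : 0 < δ) :
    ∃ φ : Cyl → ℂ, IsTest φ ∧ (∀ z, ‖g z - φ z‖ ≤ δ) ∧ ∀ z, φ z ≠ 0 → |z.1| ≤ R + 1 := by
  have hgc : HasCompactSupport g := by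
    refine HasCompactSupport.intro (K := Set.Icc (-R) R ×ˢ Set.univ)
      (isCompact_Icc.prod isCompact_univ) fun z hz => ?_
    by_contra h
    exact hz ⟨abs_le.1 (hR z h), trivial⟩
  obtain ⟨η, hη, hu⟩ := Metric.uniformContinuous_iff.1
    (hg.uniformContinuous_of_tendsto_cocompact
      hgc.is_zero_at_infty) δ hδ
  -- Radius at most `η` for the uniform estimate, at most `1` so that the support grows by no more
  -- than `1` in `t`.
  let b : ContDiffBump (0 : ℝ × ℝ) :=
    ⟨min η 1 / 2, min η 1, half_pos (lt_min hη one_pos), half_lt_self (lt_min hη one_pos)⟩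
  have hbη : b.rOut ≤ η := min_le_left _ _
  have hb1 : b.rOut ≤ 1 := min_le_right _ _
  let G : ℝ × ℝ → ℂ := fun p => g (p.1, (p.2 : S1))
  have hG : Continuous G := hg.comp isOpenQuotientMap_cover.continuous
  let φ : Cyl → ℂ := fun z => ∫ t : ℝ × ℝ, b.normed volume t • g (z - (t.1, (t.2 : S1)))
  have hφ : ∀ p : ℝ × ℝ, φ (p.1, (p.2 : S1)) =
      convolution (b.normed volume) G (ContinuousLinearMap.lsmul ℝ ℝ) volume p := fun p => rfl
  have hsupp : ∀ z, φ z ≠ 0 → |z.1| ≤ R + 1 := by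
    intro z hz
    have : ∃ t : ℝ × ℝ, b.normed volume t • g (z - (t.1, (t.2 : S1))) ≠ 0 := by
      by_contra h
      push Not at h
      exact hz (by simp only [φ, h, integral_zero])
    obtain ⟨t, ht⟩ := this
    have h1 : t ∈ Function.support (b.normed volume) := left_ne_zero_of_smul ht
    rw [b.support_normed_eq, mem_ball_zero_iff] at h1
    have h2 := hR _ (right_ne_zero_of_smul ht)
    have h3 : |t.1| ≤ 1 := (norm_fst_le t).trans (h1.le.trans hb1)
    have h4 : z.1 = (z - ((t.1, (t.2 : S1)) : Cyl)).1 + t.1 := by simp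
    rw [h4]
    exact (abs_add_le _ _).trans (add_le_add h2 h3)
  refine ⟨φ, ⟨?_, ?_⟩, ?_, hsupp⟩
  · have := b.hasCompactSupport_normed (μ := volume) |>.contDiff_convolution_left
      (𝕜 := ℝ) (n := ⊤) (ContinuousLinearMap.lsmul ℝ ℝ) (b.contDiff_normed)
      (hG.locallyIntegrable (μ := volume))
    exact this
  · refine HasCompactSupport.intro (K := Set.Icc (-(R + 1)) (R + 1) ×ˢ Set.univ)
      (isCompact_Icc.prod isCompact_univ) fun z hz => ?_
    by_contra h
    exact hz ⟨abs_le.1 (hsupp z h), trivial⟩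
  · intro z
    obtain ⟨p, rfl⟩ := isOpenQuotientMap_cover.surjective z
    change ‖g (p.1, (p.2 : S1)) - φ (p.1, (p.2 : S1))‖ ≤ δ
    rw [hφ, norm_sub_rev, ← dist_eq_norm]
    refine b.dist_normed_convolution_le (g := G) hG.aestronglyMeasurable fun q hq => ?_
    exact (hu ((dist_cover_le q p).trans_lt (hq.trans_le hbη))).le

/-- Continuous functions of compact support are dense; uniform closeness to a test function becomes
`L²` closeness because both functions vanish outside one slab of finite volume. -/
theorem exists_isTest_norm_sub_le (u : HΩ) {ε : ℝ} (hε : 0 < ε) :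
    ∃ (φ : Cyl → ℂ) (h : IsTest φ), ‖u - h.toL2‖ ≤ ε := by
  obtain ⟨g, hgc, hug, hg, hgm⟩ := (Lp.memLp u).exists_hasCompactSupport_eLpNorm_sub_le
    (by simp) (ε := ENNReal.ofReal (ε / 2)) (by simpa using hε)
  obtain ⟨R, hR⟩ : ∃ R, ∀ z : Cyl, g z ≠ 0 → |z.1| ≤ R := by
    obtain ⟨R, hR⟩ := hgc.isCompact.isBounded.subset_closedBall (0 : Cyl)
    refine ⟨R, fun z hz => ?_⟩
    have := hR (subset_closure hz)
    rw [mem_closedBall_zero_iff] at this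
    exact (norm_fst_le z).trans this
  let K : Set Cyl := Set.Icc (-(R + 1)) (R + 1) ×ˢ Set.univ
  have hK : MeasurableSet K := measurableSet_Icc.prod MeasurableSet.univ
  have hKc : IsCompact K := isCompact_Icc.prod isCompact_univ
  have hKf : (volume : Measure Cyl) K ≠ ⊤ := hKc.measure_lt_top.ne
  let c : ℝ := ((volume : Measure Cyl) K ^ (1 / (2 : ENNReal).toReal)).toReal
  have hcf : (volume : Measure Cyl) K ^ (1 / (2 : ENNReal).toReal) ≠ ⊤ := by
    exact ENNReal.rpow_ne_top_of_nonneg (by positivity) hKf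
  have hc : 0 ≤ c := ENNReal.toReal_nonneg
  -- The uniform error times `c = vol(K)^{1/2}` must stay below `ε / 2`; the added `1` avoids
  -- dividing by zero.
  obtain ⟨φ, hφ, hgφ, hφR⟩ := exists_isTest_near hg hR (δ := ε / (2 * (c + 1))) (by positivity)
  refine ⟨φ, hφ, ?_⟩
  have h2 : eLpNorm (g - φ) 2 (volume : Measure Cyl) ≤ ENNReal.ofReal (ε / 2) := by
    calc eLpNorm (g - φ) 2 (volume : Measure Cyl)
        ≤ eLpNorm (K.indicator fun _ => ε / (2 * (c + 1))) 2 volume := by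
          refine eLpNorm_mono_real fun z => ?_
          by_cases hz : z ∈ K
          · rw [Set.indicator_of_mem hz]
            exact hgφ z
          · have h : ¬ |z.1| ≤ R + 1 := fun h => hz ⟨abs_le.1 h, trivial⟩
            have h1 : φ z = 0 := by
              by_contra h0
              exact h (hφR z h0)
            have h3 : g z = 0 := by
              by_contra h0
              exact h ((hR z h0).trans (by linarith))
            simp [hz, h1, h3]
      _ = ENNReal.ofReal (ε / (2 * (c + 1))) * ENNReal.ofReal c := by
          rw [eLpNorm_indicator_const hK (by simp) (by simp), ENNReal.ofReal_toReal hcf,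
            Real.enorm_of_nonneg (by positivity)]
      _ = ENNReal.ofReal (ε / (2 * (c + 1)) * c) := by
          rw [ENNReal.ofReal_mul (by positivity)]
      _ ≤ ENNReal.ofReal (ε / 2) := by
          refine ENNReal.ofReal_le_ofReal ?_
          rw [div_mul_eq_mul_div, div_le_div_iff₀ (by positivity) (by positivity)]
          nlinarith
  have h3 : u - hφ.toL2 = ((Lp.memLp u).sub hφ.memLp).toLp _ := by
    rw [MemLp.toLp_sub (Lp.memLp u) hφ.memLp, Lp.toLp_coeFn u (Lp.memLp u)]
    rfl
  rw [h3, Lp.norm_toLp]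
  refine ENNReal.toReal_le_of_le_ofReal hε.le ?_
  have h4 : ((u : Cyl → ℂ) - φ) = (u - g) + (g - φ) := by abel
  rw [h4]
  refine (eLpNorm_add_le ((Lp.aestronglyMeasurable u).sub hgm.1)
    (hgm.1.sub hφ.memLp.1) (by simp)).trans ((add_le_add hug h2).trans ?_)
  rw [← ENNReal.ofReal_add (by positivity) (by positivity), add_halves]

theorem dense_range_toL2 : Dense {u : HΩ | ∃ (φ : Cyl → ℂ) (h : IsTest φ), h.toL2 = u} := by
  refine Metric.dense_iff.2 fun u ε hε => ?_
  obtain ⟨φ, h, hφ⟩ := exists_isTest_norm_sub_le u (half_pos hε)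
  refine ⟨h.toL2, ?_, φ, h, rfl⟩
  rw [Metric.mem_ball, dist_comm, dist_eq_norm]
  linarith

theorem inner_toL2_left {φ : Cyl → ℂ} (h : IsTest φ) (u : HΩ) :
    ⟪h.toL2, u⟫_ℂ = ∫ z, u z * star (φ z) := by
  rw [L2.inner_def]
  refine integral_congr_ae ?_
  filter_upwards [h.coeFn_toL2] with z hz
  rw [RCLike.inner_apply, hz, starRingEnd_apply]

theorem inner_toL2_right {φ : Cyl → ℂ} (h : IsTest φ) (u : HΩ) :
    ⟪u, h.toL2⟫_ℂ = ∫ z, star (u z) * φ z := by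
  rw [L2.inner_def]
  refine integral_congr_ae ?_
  filter_upwards [h.coeFn_toL2] with z hz
  rw [RCLike.inner_apply, hz, starRingEnd_apply, mul_comm]

theorem IsTest.star {φ : Cyl → ℂ} (h : IsTest φ) : IsTest fun z => star (φ z) where
  smooth := by
    have h1 : ContDiff ℝ ∞ (fun w : ℂ => (Complex.conjCLE : ℂ →L[ℝ] ℂ) w) :=
      ContinuousLinearMap.contDiff _
    exact h1.comp h.smooth
  compact := by
    have h1 : HasCompactSupport (Star.star ∘ φ) := h.compact.comp_left (star_zero ℂ)
    exact h1

theorem IsTest.translate {φ : Cyl → ℂ} (h : IsTest φ) (c : Cyl) : IsTest fun z => φ (z + c) where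
  smooth := by
    obtain ⟨q, rfl⟩ := isOpenQuotientMap_cover.surjective c
    have h1 : ContDiff ℝ ∞ (fun p : ℝ × ℝ => p + q) := contDiff_id.add contDiff_const
    exact h.smooth.comp h1
  compact := h.compact.comp_homeomorph (Homeomorph.addRight c)

/-! ## Translations and weak derivatives -/

instance : (volume : Measure Cyl).IsAddLeftInvariant :=
  inferInstanceAs ((volume : Measure ℝ).prod (volume : Measure S1)).IsAddLeftInvariant

instance : (volume : Measure Cyl).IsAddRightInvariant :=
  inferInstance

/-- Translation by `c`, as an isometry of `L²(Ω)`. -/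
def shift (c : Cyl) : HΩ →ₗᵢ[ℂ] HΩ :=
  Lp.compMeasurePreservingₗᵢ ℂ (fun z : Cyl => z + c) (measurePreserving_add_right volume c)

theorem coeFn_shift (c : Cyl) (u : HΩ) : shift c u =ᵐ[volume] fun z => u (z + c) :=
  Lp.coeFn_compMeasurePreserving u (measurePreserving_add_right volume c)

theorem shift_toL2 {φ : Cyl → ℂ} (h : IsTest φ) (c : Cyl) :
    shift c h.toL2 = (h.translate c).toL2 := by
  refine Lp.ext ?_
  filter_upwards [coeFn_shift c h.toL2, (h.translate c).coeFn_toL2,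
    (measurePreserving_add_right volume c).quasiMeasurePreserving.ae h.coeFn_toL2] with z h1 h2 h3
  rw [h1, h2, h3]

theorem shift_shift (a b : Cyl) (u : HΩ) : shift a (shift b u) = shift (a + b) u := by
  refine Lp.ext ?_
  filter_upwards [coeFn_shift a (shift b u), coeFn_shift (a + b) u,
    (measurePreserving_add_right volume a).quasiMeasurePreserving.ae (coeFn_shift b u)]
    with z h1 h2 h3
  rw [h1, h2, h3, add_assoc]

theorem shift_zero (u : HΩ) : shift 0 u = u := by
  refine Lp.ext ?_
  filter_upwards [coeFn_shift 0 u] with z h1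
  rw [h1, add_zero]

theorem inner_shift_right (c : Cyl) (u v : HΩ) : ⟪u, shift c v⟫_ℂ = ⟪shift (-c) u, v⟫_ℂ := by
  rw [← (shift (-c)).inner_map_map u, shift_shift, neg_add_cancel, shift_zero]

/-- Derivative along a curve `e` through the origin. -/
def dirDeriv (e : ℝ → Cyl) (φ : Cyl → ℂ) (z : Cyl) : ℂ := deriv (fun s : ℝ => φ (z + e s)) 0

/-- A one-parameter subgroup of the cylinder along which test functions can be differentiated. -/
structure IsDirection (e : ℝ →+ Cyl) : Prop where
  continuous : Continuous e
  isTest : ∀ {φ : Cyl → ℂ}, IsTest φ → IsTest (dirDeriv e φ)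
  hasDerivAt : ∀ {φ : Cyl → ℂ}, IsTest φ → ∀ z,
    HasDerivAt (fun s : ℝ => φ (z + e s)) (dirDeriv e φ z) 0

/-- `v` is the weak derivative of `u` along `e`, in terms of the inner product. -/
def WeakDeriv (e : ℝ → Cyl) (u v : HΩ) : Prop :=
  ∀ (φ : Cyl → ℂ) (h : IsTest φ) (hd : IsTest (dirDeriv e φ)), ⟪hd.toL2, u⟫_ℂ = -⟪h.toL2, v⟫_ℂ

theorem dirDeriv_star (e : ℝ → Cyl) (φ : Cyl → ℂ) :
    dirDeriv e (fun z => star (φ z)) = fun z => star (dirDeriv e φ z) :=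
  funext fun _ => deriv.star

theorem dirDeriv_translate (e : ℝ → Cyl) (φ : Cyl → ℂ) (c : Cyl) :
    dirDeriv e (fun z => φ (z + c)) = fun z => dirDeriv e φ (z + c) := by
  funext z
  simp only [dirDeriv, add_right_comm]

/-- Test functions are stable under conjugation, so the bilinear and the sesquilinear pairing give
the same notion. -/
theorem IsDirection.weakDeriv_iff {e : ℝ →+ Cyl} (he : IsDirection e) (u v : HΩ) :
    WeakDeriv e u v ↔
      ∀ φ : Cyl → ℂ, IsTest φ → ∫ z, u z * dirDeriv e φ z = -∫ z, v z * φ z := by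
  constructor
  · intro H φ h
    have := H _ h.star (he.isTest h.star)
    rw [inner_toL2_left, inner_toL2_left, dirDeriv_star] at this
    simpa only [star_star] using this
  · intro H φ h hd
    have := H _ h.star
    rw [inner_toL2_left, inner_toL2_left]
    rwa [dirDeriv_star] at this

theorem WeakDeriv.shift {e : ℝ →+ Cyl} {u v : HΩ} (H : WeakDeriv e u v) (c : Cyl) :
    WeakDeriv e (shift c u) (shift c v) := by
  intro φ h hd
  rw [inner_shift_right, inner_shift_right, shift_toL2, shift_toL2]
  have h1 : IsTest (dirDeriv e fun z => φ (z + -c)) := by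
    rw [dirDeriv_translate]
    exact hd.translate (-c)
  rw [← H _ (h.translate (-c)) h1]
  congr 2
  simp only [dirDeriv_translate]

/-- Differentiation under the integral; the dominating function is `|u|` times a constant on a
compact set, a product of two `L²` functions. -/
theorem IsDirection.hasDerivAt_inner_shift_zero {e : ℝ →+ Cyl} (he : IsDirection e) (u : HΩ)
    {φ : Cyl → ℂ} (h : IsTest φ) :
    HasDerivAt (fun s : ℝ => ⟪u, CylinderAlgebra.shift (e s) h.toL2⟫_ℂ)
      ⟪u, (he.isTest h).toL2⟫_ℂ 0 := by
  have hd := he.isTest h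
  obtain ⟨C, hC⟩ := hd.continuous.bounded_above_of_compact_support hd.compact
  have hC0 : 0 ≤ C := (norm_nonneg _).trans (hC 0)
  -- All points that a translation with `|s| ≤ 1` can carry into the support of the derivative.
  let K : Set Cyl := (fun p : Cyl × ℝ => p.1 - e p.2) ''
    (tsupport (dirDeriv e φ) ×ˢ Set.Icc (-1) 1)
  have hK : IsCompact K := (hd.compact.isCompact.prod isCompact_Icc).image
    (continuous_fst.sub (he.continuous.comp continuous_snd))
  have hKm : MemLp (K.indicator fun _ => C) 2 (volume : Measure Cyl) :=
    memLp_indicator_const 2 hK.measurableSet C (Or.inr hK.measure_lt_top.ne)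
  have key := (hasDerivAt_integral_of_dominated_loc_of_deriv_le (μ := (volume : Measure Cyl))
    (F := fun (s : ℝ) z => star (u z) * φ (z + e s))
    (F' := fun (s : ℝ) z => star (u z) * dirDeriv e φ (z + e s))
    (bound := fun z => ‖u z‖ * K.indicator (fun _ => C) z)
    (x₀ := (0 : ℝ)) (Icc_mem_nhds (a := (-1 : ℝ)) (b := 1) (by norm_num) (by norm_num))
    ?_ ?_ ?_ ?_ ?_ ?_).2
  · have e1 : ∀ s : ℝ, ⟪u, CylinderAlgebra.shift (e s) h.toL2⟫_ℂ =
        ∫ z, star (u z) * φ (z + e s) := fun s => by rw [shift_toL2, inner_toL2_right]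
    simp only [e1, inner_toL2_right]
    simpa only [map_zero, add_zero] using key
  · refine Eventually.of_forall fun s => ?_
    exact (Lp.aestronglyMeasurable u).star.mul
      (h.translate (e s)).continuous.aestronglyMeasurable
  · exact (Lp.memLp u).star.integrable_mul (h.translate (e 0)).memLp
  · exact (Lp.aestronglyMeasurable u).star.mul
      (hd.translate (e 0)).continuous.aestronglyMeasurable
  · refine Eventually.of_forall fun z s hs => ?_
    rw [norm_mul, norm_star]
    refine mul_le_mul_of_nonneg_left ?_ (norm_nonneg _)
    by_cases hz : dirDeriv e φ (z + e s) = 0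
    · rw [hz, norm_zero]
      exact Set.indicator_nonneg (fun _ _ => hC0) z
    · have : z ∈ K := ⟨(z + e s, s), ⟨subset_tsupport _ hz, hs⟩, add_sub_cancel_right _ _⟩
      rw [Set.indicator_of_mem this]
      exact hC _
  · exact (Lp.memLp u).norm.integrable_mul hKm
  · refine Eventually.of_forall fun z s _ => ?_
    have h1 : HasDerivAt (fun x => φ (z + e s + e (x - s))) (dirDeriv e φ (z + e s)) s := by
      refine HasDerivAt.comp_sub_const (f := fun x => φ (z + e s + e x)) s s ?_
      rw [sub_self]
      exact he.hasDerivAt h (z + e s)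
    refine (h1.congr_of_eventuallyEq (Eventually.of_forall fun x => ?_)).const_mul _
    change φ (z + e x) = φ (z + e s + e (x - s))
    rw [add_assoc, ← map_add, add_sub_cancel]

theorem IsDirection.hasDerivAt_inner_shift {e : ℝ →+ Cyl} (he : IsDirection e) (u : HΩ)
    {φ : Cyl → ℂ} (h : IsTest φ) (s : ℝ) :
    HasDerivAt (fun s : ℝ => ⟪u, CylinderAlgebra.shift (e s) h.toL2⟫_ℂ)
      ⟪u, CylinderAlgebra.shift (e s) (he.isTest h).toL2⟫_ℂ s := by
  have h1 := he.hasDerivAt_inner_shift_zero (CylinderAlgebra.shift (-e s) u) h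
  rw [← inner_shift_right] at h1
  have h2 : HasDerivAt (fun x => ⟪CylinderAlgebra.shift (-e s) u,
      CylinderAlgebra.shift (e (x - s)) h.toL2⟫_ℂ)
      ⟪u, CylinderAlgebra.shift (e s) (he.isTest h).toL2⟫_ℂ s := by
    refine HasDerivAt.comp_sub_const
      (f := fun x => ⟪CylinderAlgebra.shift (-e s) u, CylinderAlgebra.shift (e x) h.toL2⟫_ℂ) s s ?_
    rwa [sub_self]
  refine h2.congr_of_eventuallyEq (Eventually.of_forall fun x => ?_)
  change ⟪u, CylinderAlgebra.shift (e x) h.toL2⟫_ℂ =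
    ⟪CylinderAlgebra.shift (-e s) u, CylinderAlgebra.shift (e (x - s)) h.toL2⟫_ℂ
  rw [← inner_shift_right, shift_shift, ← map_add, add_sub_cancel]

/-- By duality: paired with a translated test function, `u` has derivative bounded by `‖v‖` times
the norm of that function, and the mean value inequality applies. Density extends the bound to all
`g`. -/
theorem WeakDeriv.norm_shift_sub_le {e : ℝ →+ Cyl} (he : IsDirection e) {u v : HΩ}
    (H : WeakDeriv e u v) (s : ℝ) : ‖CylinderAlgebra.shift (e s) u - u‖ ≤ |s| * ‖v‖ := by
  have key : ∀ g : HΩ, ‖⟪CylinderAlgebra.shift (e s) u - u, g⟫_ℂ‖ ≤ |s| * ‖v‖ * ‖g‖ := by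
    intro g
    refine dense_range_toL2.induction (P := fun g => ‖⟪CylinderAlgebra.shift (e s) u - u, g⟫_ℂ‖ ≤
      |s| * ‖v‖ * ‖g‖) ?_ (isClosed_le (by fun_prop) (by fun_prop)) g
    rintro _ ⟨φ, h, rfl⟩
    have hb : ∀ r : ℝ, ‖⟪u, CylinderAlgebra.shift (e r) (he.isTest h).toL2⟫_ℂ‖ ≤
        ‖v‖ * ‖h.toL2‖ := by
      intro r
      rw [shift_toL2]
      have h1 : IsTest (dirDeriv e fun z => φ (z + e r)) := by
        rw [dirDeriv_translate]
        exact (he.isTest h).translate _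
      have h2 := H _ (h.translate (e r)) h1
      have h3 : ((he.isTest h).translate (e r)).toL2 = h1.toL2 := by
        congr 1
        rw [dirDeriv_translate]
      rw [h3, norm_inner_symm, h2, norm_neg, ← shift_toL2, mul_comm ‖v‖,
        ← (CylinderAlgebra.shift (e r)).norm_map h.toL2]
      exact norm_inner_le_norm _ _
    have h4 := convex_univ.norm_image_sub_le_of_norm_hasDerivWithin_le
      (f := fun r : ℝ => ⟪u, CylinderAlgebra.shift (e r) h.toL2⟫_ℂ)
      (fun r _ => (he.hasDerivAt_inner_shift u h r).hasDerivWithinAt)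
      (fun r _ => hb r) (Set.mem_univ 0) (Set.mem_univ (-s))
    simp only [map_zero, shift_zero, sub_zero, norm_neg, Real.norm_eq_abs] at h4
    rw [inner_shift_right, map_neg, neg_neg, ← inner_sub_left] at h4
    linarith
  -- Pairing the difference with itself recovers its norm.
  have h5 := key (CylinderAlgebra.shift (e s) u - u)
  rw [inner_self_eq_norm_sq_to_K] at h5
  rcases (norm_nonneg (CylinderAlgebra.shift (e s) u - u)).eq_or_lt with h0 | h0
  · rw [← h0]
    positivity
  · refine le_of_mul_le_mul_right ?_ h0
    simpa [sq] using h5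

/-- For a bounded family, weak convergence need only be tested on a dense set. -/
theorem tendsto_inner_of_dense {E ι : Type*} [NormedAddCommGroup E] [InnerProductSpace ℂ E]
    {l : Filter ι} {w : ι → E} {v : E} {C : ℝ} (hC : ∀ i, ‖w i‖ ≤ C) (hv : ‖v‖ ≤ C) {D : Set E}
    (hD : Dense D) (H : ∀ g ∈ D, Tendsto (fun i => ⟪g, w i⟫_ℂ) l (𝓝 ⟪g, v⟫_ℂ)) (g : E) :
    Tendsto (fun i => ⟪g, w i⟫_ℂ) l (𝓝 ⟪g, v⟫_ℂ) := by
  have hC0 : 0 ≤ C := (norm_nonneg _).trans hv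
  refine Metric.tendsto_nhds.2 fun ε hε => ?_
  obtain ⟨d, hd, hgd⟩ := Metric.mem_closure_iff.1 (hD g) (ε / (3 * (C + 1))) (by positivity)
  rw [dist_eq_norm] at hgd
  have hgd' : ‖g - d‖ * C ≤ ε / 3 := by
    have : ‖g - d‖ * (C + 1) ≤ ε / (3 * (C + 1)) * (C + 1) :=
      mul_le_mul_of_nonneg_right hgd.le (by positivity)
    have h2 : ε / (3 * (C + 1)) * (C + 1) = ε / 3 := by field_simp
    nlinarith [norm_nonneg (g - d)]
  filter_upwards [Metric.tendsto_nhds.1 (H d hd) (ε / 3) (by positivity)] with i hi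
  rw [dist_eq_norm] at hi ⊢
  have e1 : ⟪g, w i⟫_ℂ - ⟪g, v⟫_ℂ =
      ⟪g - d, w i⟫_ℂ - ⟪g - d, v⟫_ℂ + (⟪d, w i⟫_ℂ - ⟪d, v⟫_ℂ) := by
    simp only [inner_sub_left]
    ring
  have h1 : ‖⟪g - d, w i⟫_ℂ‖ ≤ ε / 3 := (norm_inner_le_norm _ _).trans
    ((mul_le_mul_of_nonneg_left (hC i) (norm_nonneg _)).trans hgd')
  have h2 : ‖⟪g - d, v⟫_ℂ‖ ≤ ε / 3 := (norm_inner_le_norm _ _).trans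
    ((mul_le_mul_of_nonneg_left hv (norm_nonneg _)).trans hgd')
  rw [e1]
  linarith [norm_add_le (⟪g - d, w i⟫_ℂ - ⟪g - d, v⟫_ℂ) (⟪d, w i⟫_ℂ - ⟪d, v⟫_ℂ),
    norm_sub_le ⟪g - d, w i⟫_ℂ ⟪g - d, v⟫_ℂ]

/-- Translation by `e s` has adjoint translation by `e (-s)`, so exchanging the two sides of an
inner product conjugates and reflects the parameter. -/
theorem hasDerivAt_star_comp_neg {f : ℝ → ℂ} {f' : ℂ} (h : HasDerivAt f f' 0) :
    HasDerivAt (fun s => star (f (-s))) (-star f') 0 := by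
  rw [← neg_zero] at h
  have h1 := (h.scomp (0 : ℝ) (hasDerivAt_neg 0)).star
  simpa [Function.comp_def] using h1

/-- The difference quotients are bounded by `‖v‖`, so test functions suffice; for these the
translation moves to the test function and the limit is the definition of `WeakDeriv`. Integration
by parts, uniqueness and the self-adjointness of `DₜΛ`, `D_βΛ` all follow by differentiating one
function of `s` in two ways. -/
theorem WeakDeriv.hasDerivAt_inner_shift {e : ℝ →+ Cyl} (he : IsDirection e) {u v : HΩ}
    (H : WeakDeriv e u v) (g : HΩ) :
    HasDerivAt (fun s : ℝ => ⟪g, CylinderAlgebra.shift (e s) u⟫_ℂ) ⟪g, v⟫_ℂ 0 := by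
  have hs : ∀ (s : ℝ) (g : HΩ), s⁻¹ • (⟪g, CylinderAlgebra.shift (e (0 + s)) u⟫_ℂ -
      ⟪g, CylinderAlgebra.shift (e 0) u⟫_ℂ) =
      ⟪g, ((s⁻¹ : ℝ) : ℂ) • (CylinderAlgebra.shift (e s) u - u)⟫_ℂ := by
    intro s g
    rw [inner_smul_right, inner_sub_right, map_zero, shift_zero, zero_add, Complex.real_smul]
  rw [hasDerivAt_iff_tendsto_slope_zero]
  simp only [hs]
  refine tendsto_inner_of_dense (C := ‖v‖) (fun s => ?_) le_rfl dense_range_toL2 ?_ g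
  · rw [norm_smul, Complex.norm_real, Real.norm_eq_abs, abs_inv]
    rcases eq_or_ne s 0 with rfl | h0
    -- The quotient at `s = 0` is zero, since `0⁻¹ = 0`.
    · simp
    · rw [inv_mul_le_iff₀ (abs_pos.2 h0)]
      exact H.norm_shift_sub_le he s
  · rintro _ ⟨φ, h, rfl⟩
    have h1 := hasDerivAt_star_comp_neg (he.hasDerivAt_inner_shift_zero u h)
    have h2 : ∀ s : ℝ, Star.star ⟪u, CylinderAlgebra.shift (e (-s)) h.toL2⟫_ℂ =
        ⟪h.toL2, CylinderAlgebra.shift (e s) u⟫_ℂ := fun s => by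
      rw [← starRingEnd_apply, inner_conj_symm, inner_shift_right, map_neg]
    simp only [h2] at h1
    rw [← starRingEnd_apply, inner_conj_symm, H φ h (he.isTest h), neg_neg,
      hasDerivAt_iff_tendsto_slope_zero] at h1
    simpa only [hs] using h1

/-- Integration by parts for weakly differentiable functions. -/
theorem WeakDeriv.inner_eq_neg {e : ℝ →+ Cyl} (he : IsDirection e) {u v a b : HΩ}
    (H : WeakDeriv e u v) (H' : WeakDeriv e a b) : ⟪a, v⟫_ℂ = -⟪b, u⟫_ℂ := by
  have h1 := H.hasDerivAt_inner_shift he a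
  have h2 := hasDerivAt_star_comp_neg (H'.hasDerivAt_inner_shift he u)
  have h3 : ∀ s : ℝ, Star.star ⟪u, CylinderAlgebra.shift (e (-s)) a⟫_ℂ =
      ⟪a, CylinderAlgebra.shift (e s) u⟫_ℂ := fun s => by
    rw [← starRingEnd_apply, inner_conj_symm, inner_shift_right, map_neg]
  simp only [h3] at h2
  rw [← starRingEnd_apply, inner_conj_symm] at h2
  exact h1.unique h2

theorem IsTest.weakDeriv {e : ℝ →+ Cyl} (he : IsDirection e) {φ : Cyl → ℂ} (h : IsTest φ) :
    WeakDeriv e h.toL2 (he.isTest h).toL2 := by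
  intro ψ k kd
  have h1 := he.hasDerivAt_inner_shift_zero k.toL2 h
  have h2 := hasDerivAt_star_comp_neg (he.hasDerivAt_inner_shift_zero h.toL2 k)
  have h3 : ∀ s : ℝ, Star.star ⟪h.toL2, shift (e (-s)) k.toL2⟫_ℂ =
      ⟪k.toL2, shift (e s) h.toL2⟫_ℂ := fun s => by
    rw [← starRingEnd_apply, inner_conj_symm, inner_shift_right, map_neg]
  simp only [h3] at h2
  rw [← starRingEnd_apply, inner_conj_symm] at h2
  rw [h1.unique h2, neg_neg]

theorem WeakDeriv.unique {e : ℝ →+ Cyl} (he : IsDirection e) {u v w : HΩ}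
    (H : WeakDeriv e u v) (H' : WeakDeriv e u w) : v = w :=
  ext_inner_left ℂ fun g =>
    (H.hasDerivAt_inner_shift he g).unique (H'.hasDerivAt_inner_shift he g)

/-! ## The two directions of the cylinder -/

/-- The subgroup of translations in the direction of `ℝ`. -/
def dirT : ℝ →+ Cyl := AddMonoidHom.inl ℝ S1

/-- The one-parameter group of translations in the direction of `𝕊¹`. -/
def dirX : ℝ →+ Cyl := (AddMonoidHom.inr ℝ S1).comp (QuotientAddGroup.mk' _)

theorem dirT_apply (s : ℝ) : dirT s = (s, 0) := rfl

theorem dirX_apply (s : ℝ) : dirX s = (0, (s : S1)) := rfl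

theorem add_dirT (z : Cyl) (s : ℝ) : z + dirT s = (z.1 + s, z.2) := by
  rw [dirT_apply]
  ext <;> simp

theorem add_dirX (z : Cyl) (s : ℝ) : z + dirX s = (z.1, z.2 + (s : S1)) := by
  rw [dirX_apply]
  ext <;> simp

theorem dirDeriv_dirT (φ : Cyl → ℂ) : dirDeriv dirT φ = dt φ := by
  funext z
  simp only [dirDeriv, dt, add_dirT]

theorem dirDeriv_dirX (φ : Cyl → ℂ) : dirDeriv dirX φ = dx φ := by
  funext z
  simp only [dirDeriv, dx, add_dirX]

theorem IsTest.isTest_dt {φ : Cyl → ℂ} (h : IsTest φ) : IsTest (dt φ) where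
  smooth := by
    have h1 : (fun p : ℝ × ℝ => dt φ (p.1, (p.2 : S1))) =
        fun p => fderiv ℝ (fun p : ℝ × ℝ => φ (p.1, (p.2 : S1))) p (1, 0) :=
      funext fun p => dt_cover h p
    rw [h1]
    exact (h.smooth.fderiv_right (m := ∞) (by simp)).clm_apply contDiff_const
  compact := h.compact_dt

theorem IsTest.isTest_dx {φ : Cyl → ℂ} (h : IsTest φ) : IsTest (dx φ) where
  smooth := by
    have h1 : (fun p : ℝ × ℝ => dx φ (p.1, (p.2 : S1))) =
        fun p => fderiv ℝ (fun p : ℝ × ℝ => φ (p.1, (p.2 : S1))) p (0, 1) :=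
      funext fun p => dx_cover h p
    rw [h1]
    exact (h.smooth.fderiv_right (m := ∞) (by simp)).clm_apply contDiff_const
  compact := h.compact_dx

theorem isDirection_dirT : IsDirection dirT where
  continuous := continuous_id.prodMk continuous_const
  isTest h := by
    rw [dirDeriv_dirT]
    exact h.isTest_dt
  hasDerivAt {φ} h z := by
    refine DifferentiableAt.hasDerivAt ?_
    obtain ⟨p, rfl⟩ := isOpenQuotientMap_cover.surjective z
    simp only [add_dirT]
    have h1 : Differentiable ℝ fun s : ℝ => (p.1 + s, p.2) := by fun_prop
    exact ((h.smooth.differentiable (by simp)).comp h1) 0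

theorem isDirection_dirX : IsDirection dirX where
  continuous := continuous_const.prodMk (AddCircle.continuous_mk' _)
  isTest h := by
    rw [dirDeriv_dirX]
    exact h.isTest_dx
  hasDerivAt {φ} h z := by
    refine DifferentiableAt.hasDerivAt ?_
    obtain ⟨p, rfl⟩ := isOpenQuotientMap_cover.surjective z
    simp only [add_dirX]
    have h1 : Differentiable ℝ fun s : ℝ => (p.1, p.2 + s) := by fun_prop
    exact ((h.smooth.differentiable (by simp)).comp h1) 0

theorem isWeakDt_iff (u v : HΩ) : IsWeakDt u v ↔ WeakDeriv dirT u v := by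
  rw [isDirection_dirT.weakDeriv_iff]
  simp only [dirDeriv_dirT]
  rfl

theorem isWeakDx_iff (u v : HΩ) : IsWeakDx u v ↔ WeakDeriv dirX u v := by
  rw [isDirection_dirX.weakDeriv_iff]
  simp only [dirDeriv_dirX]
  rfl

/-! ## The Sobolev space -/

theorem weakDeriv_gradT (V : Sobolev) : WeakDeriv dirT (incl V) (gradT V) :=
  (isWeakDt_iff _ _).1 V.2.1

theorem weakDeriv_gradX (V : Sobolev) : WeakDeriv dirX (incl V) (gradX V) :=
  (isWeakDx_iff _ _).1 V.2.2

theorem incl_injective : Function.Injective incl := by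
  intro V W h
  refine Subtype.ext (PiLp.ext fun i => ?_)
  fin_cases i
  · exact h
  · exact (weakDeriv_gradT V).unique isDirection_dirT (h ▸ weakDeriv_gradT W)
  · exact (weakDeriv_gradX V).unique isDirection_dirX (h ▸ weakDeriv_gradX W)

theorem sobolev_inner (V W : Sobolev) :
    ⟪V, W⟫_ℂ = ⟪incl V, incl W⟫_ℂ + ⟪gradT V, gradT W⟫_ℂ + ⟪gradX V, gradX W⟫_ℂ := by
  rw [Submodule.coe_inner, PiLp.inner_apply, Fin.sum_univ_three]
  rfl

theorem exists_sobolev {u v w : HΩ} (hv : WeakDeriv dirT u v) (hw : WeakDeriv dirX u w) :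
    ∃ V : Sobolev, incl V = u ∧ gradT V = v ∧ gradX V = w :=
  ⟨⟨WithLp.toLp 2 ![u, v, w], (isWeakDt_iff _ _).2 hv, (isWeakDx_iff _ _).2 hw⟩, rfl, rfl, rfl⟩

theorem denseRange_incl : DenseRange incl := by
  refine dense_range_toL2.mono ?_
  rintro _ ⟨φ, h, rfl⟩
  obtain ⟨V, hV, -⟩ := exists_sobolev (h.weakDeriv isDirection_dirT)
    (h.weakDeriv isDirection_dirX)
  exact ⟨V, hV⟩

/-- The weak form of `(1 - Δ) W = f`. Identities for `resolventLap` are proved by exhibiting the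
solution and checking this equation. -/
theorem adjoint_incl_eq_iff (f : HΩ) (W : Sobolev) :
    ContinuousLinearMap.adjoint incl f = W ↔ ∀ V : Sobolev, ⟪V, W⟫_ℂ = ⟪incl V, f⟫_ℂ := by
  constructor
  · rintro rfl V
    rw [ContinuousLinearMap.adjoint_inner_right]
  · intro h
    refine ext_inner_left ℂ fun V => ?_
    rw [h, ContinuousLinearMap.adjoint_inner_right]

theorem exists_shift_sobolev (c : Cyl) (V : Sobolev) : ∃ W : Sobolev,
    incl W = shift c (incl V) ∧ gradT W = shift c (gradT V) ∧ gradX W = shift c (gradX V) :=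
  exists_sobolev ((weakDeriv_gradT V).shift c) ((weakDeriv_gradX V).shift c)

/-- The form on `H¹(Ω)` is translation invariant, hence so is its solution operator. -/
theorem resolventLap_shift (c : Cyl) (f : HΩ) :
    resolventLap (shift c f) = shift c (resolventLap f) := by
  obtain ⟨W, h0, h1, h2⟩ := exists_shift_sobolev c (ContinuousLinearMap.adjoint incl f)
  have h3 : ContinuousLinearMap.adjoint incl (shift c f) = W := by
    rw [adjoint_incl_eq_iff]
    intro V
    obtain ⟨V', k0, k1, k2⟩ := exists_shift_sobolev (-c) V
    rw [sobolev_inner, h0, h1, h2, inner_shift_right, inner_shift_right, inner_shift_right,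
      inner_shift_right, ← k0, ← k1, ← k2, ← sobolev_inner,
      ← ContinuousLinearMap.adjoint_inner_right]
  change incl (ContinuousLinearMap.adjoint incl (shift c f)) = _
  rw [h3, h0]
  rfl

/-! ### Properties of `Λ`, `DₜΛ` and `D_βΛ` -/

theorem commute_sqrtOp {E : Type*} [NormedAddCommGroup E] [InnerProductSpace ℂ E]
    [CompleteSpace E] {T S : E →L[ℂ] E} (h : Commute T S) : Commute (sqrtOp T) S :=
  h.cfcₙ_nnreal _

theorem bessel_shift (c : Cyl) (f : HΩ) : bessel (shift c f) = shift c (bessel f) := by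
  have h1 : Commute resolventLap (shift c).toContinuousLinearMap :=
    ContinuousLinearMap.ext fun f => resolventLap_shift c f
  have h2 : Commute bessel (shift c).toContinuousLinearMap := commute_sqrtOp h1
  exact congrArg (fun T : HΩ →L[ℂ] HΩ => T f) h2.eq

theorem inner_bessel_left (f g : HΩ) : ⟪bessel f, g⟫_ℂ = ⟪f, bessel g⟫_ℂ := by
  have h : ContinuousLinearMap.adjoint bessel = bessel :=
    (IsSelfAdjoint.of_nonneg bessel_nonneg).adjoint_eq
  rw [← ContinuousLinearMap.adjoint_inner_right, h]

theorem bessel_bessel (f : HΩ) : bessel (bessel f) = resolventLap f :=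
  congrArg (fun T : HΩ →L[ℂ] HΩ => T f) bessel_mul_self

/-- If `Λ f = 0` then the adjoint of `incl` kills `f`, so `f` is orthogonal to the dense subspace
`H¹(Ω)`. -/
theorem bessel_injective : Function.Injective bessel := by
  refine (injective_iff_map_eq_zero bessel).2 fun f hf => ?_
  have h1 : ContinuousLinearMap.adjoint incl f = 0 := by
    refine incl_injective ?_
    change resolventLap f = _
    rw [← bessel_bessel, hf, map_zero, map_zero]
  rw [← inner_self_eq_zero (𝕜 := ℂ)]
  refine denseRange_incl.induction (P := fun g => ⟪g, f⟫_ℂ = 0) ?_ ?_ f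
  · rintro _ ⟨V, rfl⟩
    rw [← ContinuousLinearMap.adjoint_inner_right, h1, inner_zero_right]
  · exact isClosed_eq (by fun_prop) continuous_const

theorem denseRange_bessel : DenseRange bessel := by
  have h : (LinearMap.range bessel.toLinearMap)ᗮ = ⊥ := by
    rw [eq_bot_iff]
    intro g hg
    refine bessel_injective ?_
    rw [map_zero, ← inner_self_eq_zero (𝕜 := ℂ), ← inner_bessel_left]
    exact hg _ ⟨bessel g, rfl⟩
  have := (Submodule.topologicalClosure_eq_top_iff).2 h
  exact Submodule.dense_iff_topologicalClosure_eq_top.2 this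

theorem denseRange_resolventLap : DenseRange resolventLap := by
  have h := denseRange_bessel.comp denseRange_bessel bessel.continuous
  have h1 : bessel ∘ bessel = resolventLap := funext bessel_bessel
  rwa [h1] at h

theorem besselLift_bessel (f : HΩ) :
    besselLift (bessel f) = ContinuousLinearMap.adjoint incl f := by
  refine incl_injective ?_
  rw [incl_besselLift, bessel_bessel]
  rfl

/-- On the dense range of `Λ` this is `norm_adjoint_incl`. The isometry turns `L²` bounds into
simultaneous bounds for a function and its two derivatives. -/
theorem norm_besselLift (f : HΩ) : ‖besselLift f‖ = ‖f‖ := by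
  refine denseRange_bessel.induction (P := fun g => ‖besselLift g‖ = ‖g‖) ?_ ?_ f
  · rintro _ ⟨g, rfl⟩
    rw [besselLift_bessel, norm_adjoint_incl]
  · exact isClosed_eq (by fun_prop) continuous_norm

theorem inner_besselLift (f g : HΩ) : ⟪besselLift f, besselLift g⟫_ℂ = ⟪f, g⟫_ℂ :=
  (⟨besselLift.toLinearMap, norm_besselLift⟩ : HΩ →ₗᵢ[ℂ] Sobolev).inner_map_map f g

theorem norm_gradT_le (V : Sobolev) : ‖gradT V‖ ≤ ‖V‖ := PiLp.norm_apply_le V.1 1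

theorem norm_gradX_le (V : Sobolev) : ‖gradX V‖ ≤ ‖V‖ := PiLp.norm_apply_le V.1 2

theorem norm_incl_le (V : Sobolev) : ‖incl V‖ ≤ ‖V‖ := PiLp.norm_apply_le V.1 0

theorem gradT_besselLift (f : HΩ) : gradT (besselLift f) = Complex.I • DtBessel f := by
  rw [DtBessel, smul_apply, smul_smul, mul_one_div_cancel Complex.I_ne_zero, one_smul]
  rfl

theorem gradX_besselLift (f : HΩ) : gradX (besselLift f) = Complex.I • DxBessel f := by
  rw [DxBessel, smul_apply, smul_smul, mul_one_div_cancel Complex.I_ne_zero, one_smul]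
  rfl

/-- `Λ` is symmetric and commutes with translations, so `⟪f, shift (e s) (bessel g)⟫` can be
differentiated from either side; the sign of integration by parts cancels against the conjugate of
`i`. -/
theorem isSelfAdjoint_of_weakDeriv {e : ℝ →+ Cyl} (he : IsDirection e) {D : HΩ →L[ℂ] HΩ}
    (hD : ∀ f, WeakDeriv e (bessel f) (Complex.I • D f)) : IsSelfAdjoint D := by
  rw [ContinuousLinearMap.isSelfAdjoint_iff_isSymmetric]
  intro f g
  have h1 := (hD g).hasDerivAt_inner_shift he f
  have h2 := hasDerivAt_star_comp_neg ((hD f).hasDerivAt_inner_shift he g)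
  have h3 : ∀ s : ℝ, Star.star ⟪g, shift (e (-s)) (bessel f)⟫_ℂ =
      ⟪f, shift (e s) (bessel g)⟫_ℂ := fun s => by
    rw [← starRingEnd_apply, inner_conj_symm, ← bessel_shift, inner_bessel_left,
      inner_shift_right, map_neg]
  simp only [h3] at h2
  rw [← starRingEnd_apply, inner_conj_symm] at h2
  have h4 := h1.unique h2
  rw [inner_smul_right, inner_smul_left, Complex.conj_I, neg_mul, neg_neg] at h4
  exact (mul_left_cancel₀ Complex.I_ne_zero h4).symm

theorem isSelfAdjoint_bessel : IsSelfAdjoint bessel := IsSelfAdjoint.of_nonneg bessel_nonneg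

theorem isSelfAdjoint_DtBessel : IsSelfAdjoint DtBessel :=
  isSelfAdjoint_of_weakDeriv isDirection_dirT fun f => (isWeakDt_iff _ _).1 (isWeakDt_bessel f)

theorem isSelfAdjoint_DxBessel : IsSelfAdjoint DxBessel :=
  isSelfAdjoint_of_weakDeriv isDirection_dirX fun f => (isWeakDx_iff _ _).1 (isWeakDx_bessel f)

/-- `Λ² + (DₜΛ)² + (D_βΛ)² = 1`. -/
theorem bessel_sq_add : bessel * bessel + DtBessel * DtBessel + DxBessel * DxBessel = 1 := by
  refine ContinuousLinearMap.ext fun f => ext_inner_left ℂ fun g => ?_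
  have h := inner_besselLift g f
  rw [sobolev_inner, gradT_besselLift, gradT_besselLift, gradX_besselLift, gradX_besselLift,
    incl_besselLift, incl_besselLift] at h
  simp only [inner_smul_left, inner_smul_right, Complex.conj_I] at h
  have ht : ⟪DtBessel g, DtBessel f⟫_ℂ = ⟪g, DtBessel (DtBessel f)⟫_ℂ :=
    (ContinuousLinearMap.isSelfAdjoint_iff_isSymmetric.1 isSelfAdjoint_DtBessel) _ _
  have hx : ⟪DxBessel g, DxBessel f⟫_ℂ = ⟪g, DxBessel (DxBessel f)⟫_ℂ :=
    (ContinuousLinearMap.isSelfAdjoint_iff_isSymmetric.1 isSelfAdjoint_DxBessel) _ _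
  rw [inner_bessel_left, ht, hx] at h
  change ⟪g, bessel (bessel f) + DtBessel (DtBessel f) + DxBessel (DxBessel f)⟫_ℂ = ⟪g, f⟫_ℂ
  rw [inner_add_right, inner_add_right, ← h]
  have hI := Complex.I_mul_I
  linear_combination (⟪g, DtBessel (DtBessel f)⟫_ℂ + ⟪g, DxBessel (DxBessel f)⟫_ℂ) * hI

/-! ## Multiplication operators and plane waves -/

theorem mulOp_mul (f g : Cyl →ᵇ ℂ) : mulOp (f * g) = mulOp f * mulOp g := by
  refine ContinuousLinearMap.ext fun u => Lp.ext ?_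
  filter_upwards [coeFn_mulOp (f * g) u, coeFn_mulOp f (mulOp g u), coeFn_mulOp g u]
    with z h1 h2 h3
  change mulOp (f * g) u z = mulOp f (mulOp g u) z
  rw [h1, h2, h3, BoundedContinuousFunction.mul_apply, mul_assoc]

theorem mulOp_one : mulOp 1 = 1 := by
  refine ContinuousLinearMap.ext fun u => Lp.ext ?_
  filter_upwards [coeFn_mulOp 1 u] with z h1
  rw [h1, BoundedContinuousFunction.coe_one, Pi.one_apply, one_mul]
  rfl

theorem mulOp_add (f g : Cyl →ᵇ ℂ) : mulOp (f + g) = mulOp f + mulOp g := by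
  refine ContinuousLinearMap.ext fun u => Lp.ext ?_
  filter_upwards [coeFn_mulOp (f + g) u, coeFn_mulOp f u, coeFn_mulOp g u,
    Lp.coeFn_add (mulOp f u) (mulOp g u)] with z h1 h2 h3 h4
  change _ = (mulOp f u + mulOp g u) z
  rw [h1, h4, Pi.add_apply, h2, h3, BoundedContinuousFunction.coe_add, Pi.add_apply, add_mul]

theorem mulOp_smul (c : ℂ) (f : Cyl →ᵇ ℂ) : mulOp (c • f) = c • mulOp f := by
  refine ContinuousLinearMap.ext fun u => Lp.ext ?_
  filter_upwards [coeFn_mulOp (c • f) u, coeFn_mulOp f u, Lp.coeFn_smul c (mulOp f u)]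
    with z h1 h2 h3
  change _ = (c • mulOp f u) z
  rw [h1, h3, Pi.smul_apply, h2]
  exact mul_assoc c (f z) (u z)

theorem norm_mulOp_apply_le (f : Cyl →ᵇ ℂ) (u : HΩ) : ‖mulOp f u‖ ≤ ‖f‖ * ‖u‖ :=
  (mulOp f).le_of_opNorm_le (LinearMap.mkContinuous_norm_le _ (norm_nonneg _) _) u

theorem inner_mulOp_right (f : Cyl →ᵇ ℂ) (u v : HΩ) :
    ⟪u, mulOp f v⟫_ℂ = ⟪mulOp (star f) u, v⟫_ℂ := by
  rw [L2.inner_def, L2.inner_def]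
  refine integral_congr_ae ?_
  filter_upwards [coeFn_mulOp f v, coeFn_mulOp (star f) u] with z h1 h2
  rw [RCLike.inner_apply, RCLike.inner_apply, h1, h2, map_mul, BoundedContinuousFunction.star_apply,
    starRingEnd_apply, starRingEnd_apply, star_star]
  ring

theorem star_mulOp (f : Cyl →ᵇ ℂ) : star (mulOp f) = mulOp (star f) := by
  rw [ContinuousLinearMap.star_eq_adjoint, eq_comm, ContinuousLinearMap.eq_adjoint_iff]
  intro u v
  rw [inner_mulOp_right]

/-- The plane wave `e^{ikt} e^{imβ}`. -/
def planeWave (k : ℝ) (m : ℤ) : Cyl →ᵇ ℂ :=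
  BoundedContinuousFunction.ofNormedAddCommGroup
    (fun z : Cyl => Complex.exp (Complex.I * k * z.1) * fourier m z.2)
    (by
      have := (fourier (T := 2 * Real.pi) m).continuous
      fun_prop) 1
    (fun z => by
      rw [norm_mul, fourier_apply, Circle.norm_coe]
      simp [Complex.norm_exp])

theorem planeWave_apply (k : ℝ) (m : ℤ) (z : Cyl) :
    planeWave k m z = Complex.exp (Complex.I * k * z.1) * fourier m z.2 := rfl

theorem planeWave_add (k l : ℝ) (m n : ℤ) :
    planeWave (k + l) (m + n) = planeWave k m * planeWave l n := by
  ext z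
  rw [BoundedContinuousFunction.mul_apply, planeWave_apply, planeWave_apply, planeWave_apply,
    fourier_add]
  push_cast
  rw [mul_add, add_mul, Complex.exp_add]
  ring

theorem planeWave_zero : planeWave 0 0 = 1 := by
  ext z
  simp [planeWave_apply]

theorem star_planeWave (k : ℝ) (m : ℤ) : star (planeWave k m) = planeWave (-k) (-m) := by
  ext z
  rw [BoundedContinuousFunction.star_apply, planeWave_apply, planeWave_apply, fourier_neg,
    ← starRingEnd_apply, map_mul, ← Complex.exp_conj]
  simp

theorem mulOp_planeWave_neg (k : ℝ) (m : ℤ) (u : HΩ) :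
    mulOp (planeWave (-k) (-m)) (mulOp (planeWave k m) u) = u := by
  have h : mulOp (planeWave (-k) (-m)) * mulOp (planeWave k m) = 1 := by
    rw [← mulOp_mul, ← planeWave_add, neg_add_cancel, neg_add_cancel, planeWave_zero, mulOp_one]
  exact congrArg (fun T : HΩ →L[ℂ] HΩ => T u) h

theorem inner_planeWave_right (k : ℝ) (m : ℤ) (u v : HΩ) :
    ⟪u, mulOp (planeWave k m) v⟫_ℂ = ⟪mulOp (planeWave (-k) (-m)) u, v⟫_ℂ := by
  rw [inner_mulOp_right, star_planeWave]

theorem norm_mulOp_planeWave (k : ℝ) (m : ℤ) (u : HΩ) : ‖mulOp (planeWave k m) u‖ = ‖u‖ := by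
  have h : ⟪mulOp (planeWave k m) u, mulOp (planeWave k m) u⟫_ℂ = ⟪u, u⟫_ℂ := by
    rw [inner_planeWave_right, mulOp_planeWave_neg]
  rw [inner_self_eq_norm_sq_to_K, inner_self_eq_norm_sq_to_K] at h
  have h2 : ‖mulOp (planeWave k m) u‖ ^ 2 = ‖u‖ ^ 2 := by exact_mod_cast h
  exact (sq_eq_sq₀ (norm_nonneg _) (norm_nonneg _)).1 h2

/-! ### Modulation by plane waves and weak derivatives -/

theorem IsTest.planeWave_mul {φ : Cyl → ℂ} (h : IsTest φ) (k : ℝ) (m : ℤ) :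
    IsTest fun z => planeWave k m z * φ z where
  smooth := by
    refine ContDiff.mul ?_ h.smooth
    simp only [planeWave_apply, fourier_coe_apply]
    have h1 : ContDiff ℝ ∞ fun p : ℝ × ℝ => ((p.1 : ℝ) : ℂ) :=
      Complex.ofRealCLM.contDiff.comp contDiff_fst
    have h2 : ContDiff ℝ ∞ fun p : ℝ × ℝ => ((p.2 : ℝ) : ℂ) :=
      Complex.ofRealCLM.contDiff.comp contDiff_snd
    exact (contDiff_const.mul h1).cexp.mul ((contDiff_const.mul h2).div_const _).cexp
  compact := h.compact.mul_left

theorem mulOp_planeWave_toL2 {φ : Cyl → ℂ} (h : IsTest φ) (k : ℝ) (m : ℤ) :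
    mulOp (planeWave k m) h.toL2 = (h.planeWave_mul k m).toL2 := by
  refine Lp.ext ?_
  filter_upwards [coeFn_mulOp (planeWave k m) h.toL2, h.coeFn_toL2,
    (h.planeWave_mul k m).coeFn_toL2] with z h1 h2 h3
  rw [h1, h2, h3]

theorem planeWave_add_dirT (k : ℝ) (m : ℤ) (z : Cyl) (s : ℝ) :
    planeWave k m (z + dirT s) = planeWave k m z * Complex.exp (Complex.I * k * s) := by
  rw [add_dirT, planeWave_apply, planeWave_apply]
  push_cast
  rw [mul_add, Complex.exp_add]
  ring

theorem planeWave_add_dirX (k : ℝ) (m : ℤ) (z : Cyl) (s : ℝ) :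
    planeWave k m (z + dirX s) = planeWave k m z * Complex.exp (Complex.I * (m : ℝ) * s) := by
  have h : fourier m (s : S1) = Complex.exp (Complex.I * (m : ℝ) * s) := by
    rw [fourier_coe_apply]
    congr 1
    have := Real.pi_ne_zero
    push_cast
    field_simp
  have h2 : fourier m (z.2 + (s : S1)) = fourier m z.2 * fourier m (s : S1) := by
    rw [fourier_apply, fourier_apply, fourier_apply, smul_add, AddCircle.toCircle_add,
      Circle.coe_mul]
  rw [add_dirX, planeWave_apply, planeWave_apply, h2, h]
  ring

/-- The Leibniz rule. The hypothesis `hc` records the frequency `c` of the wave along `e`, so that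
both directions are treated at once. -/
theorem dirDeriv_planeWave_mul {e : ℝ →+ Cyl} (he : IsDirection e) {k : ℝ} {m : ℤ} {c : ℝ}
    (hc : ∀ z s, planeWave k m (z + e s) = planeWave k m z * Complex.exp (Complex.I * c * s))
    {φ : Cyl → ℂ} (h : IsTest φ) (z : Cyl) :
    dirDeriv e (fun z => planeWave k m z * φ z) z =
      planeWave k m z * dirDeriv e φ z + Complex.I * c * (planeWave k m z * φ z) := by
  have h1 : HasDerivAt (fun s : ℝ => Complex.exp (Complex.I * c * s))
      (Complex.exp (Complex.I * c * (0 : ℝ)) * (Complex.I * c * 1)) 0 :=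
    ((Complex.ofRealCLM.hasDerivAt (x := (0 : ℝ))).const_mul (Complex.I * c)).cexp
  have h2 := (h1.const_mul (planeWave k m z)).mul (he.hasDerivAt h z)
  have h3 : (fun s : ℝ => planeWave k m (z + e s) * φ (z + e s)) =
      (fun s : ℝ => planeWave k m z * Complex.exp (Complex.I * c * s)) *
        fun s : ℝ => φ (z + e s) := by
    funext s
    rw [hc]
    rfl
  rw [dirDeriv, h3, h2.deriv]
  simp
  ring

/-- The product rule by duality: the inverse wave is moved to the test function, which is why `hc`
concerns `-k`, `-m` and `-c`. -/
theorem WeakDeriv.planeWave {e : ℝ →+ Cyl} (he : IsDirection e) {k : ℝ} {m : ℤ} {c : ℝ}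
    (hc : ∀ z s, planeWave (-k) (-m) (z + e s) =
      planeWave (-k) (-m) z * Complex.exp (Complex.I * ((-c : ℝ) : ℂ) * s))
    {u v : HΩ} (H : WeakDeriv e u v) :
    WeakDeriv e (mulOp (CylinderAlgebra.planeWave k m) u)
      (mulOp (CylinderAlgebra.planeWave k m) v +
        (Complex.I * c) • mulOp (CylinderAlgebra.planeWave k m) u) := by
  intro φ h hd
  have h1 := h.planeWave_mul (-k) (-m)
  have h2 := H _ h1 (he.isTest h1)
  have h3 : (he.isTest h1).toL2 = mulOp (CylinderAlgebra.planeWave (-k) (-m)) hd.toL2 +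
      (Complex.I * ((-c : ℝ) : ℂ)) • h1.toL2 := by
    refine Lp.ext ?_
    filter_upwards [(he.isTest h1).coeFn_toL2, h1.coeFn_toL2, hd.coeFn_toL2,
      coeFn_mulOp (CylinderAlgebra.planeWave (-k) (-m)) hd.toL2,
      Lp.coeFn_add (mulOp (CylinderAlgebra.planeWave (-k) (-m)) hd.toL2)
        ((Complex.I * ((-c : ℝ) : ℂ)) • h1.toL2),
      Lp.coeFn_smul (Complex.I * ((-c : ℝ) : ℂ)) h1.toL2] with z k1 k2 k3 k4 k5 k6
    rw [k1, k5, Pi.add_apply, k4, k6, Pi.smul_apply, k2, k3, dirDeriv_planeWave_mul he hc h]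
    rfl
  rw [h3, inner_add_left, inner_smul_left] at h2
  rw [inner_add_right, inner_smul_right, inner_planeWave_right, inner_planeWave_right,
    inner_planeWave_right, mulOp_planeWave_toL2 h]
  simp only [map_mul, Complex.conj_I, Complex.conj_ofReal] at h2
  push_cast at h2
  linear_combination h2

theorem exists_planeWave_sobolev (k : ℝ) (m : ℤ) (V : Sobolev) : ∃ W : Sobolev,
    incl W = mulOp (planeWave k m) (incl V) ∧
    gradT W = mulOp (planeWave k m) (gradT V) +
      (Complex.I * k) • mulOp (planeWave k m) (incl V) ∧
    gradX W = mulOp (planeWave k m) (gradX V) +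
      (Complex.I * (m : ℝ)) • mulOp (planeWave k m) (incl V) :=
  exists_sobolev
    ((weakDeriv_gradT V).planeWave isDirection_dirT (planeWave_add_dirT (-k) (-m)))
    ((weakDeriv_gradX V).planeWave isDirection_dirX fun z s => by
      rw [planeWave_add_dirX]
      push_cast
      rfl)

/-- Commuting a plane wave `e^{ikt} e^{imβ}` with `(1 - Δ)⁻¹`. -/
theorem planeWave_resolventLap (k : ℝ) (m : ℤ) (f : HΩ) :
    mulOp (planeWave k m) (resolventLap f) =
      resolventLap (mulOp (planeWave k m) (f + (2 * k : ℂ) • DtBessel (bessel f) +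
        (2 * m : ℂ) • DxBessel (bessel f) + (k ^ 2 + m ^ 2 : ℂ) • resolventLap f)) := by
  set Φ := ContinuousLinearMap.adjoint incl f with hΦ
  have hΦ0 : incl Φ = resolventLap f := rfl
  have hΦ1 : gradT Φ = Complex.I • DtBessel (bessel f) := by
    rw [hΦ, ← besselLift_bessel, gradT_besselLift]
  have hΦ2 : gradX Φ = Complex.I • DxBessel (bessel f) := by
    rw [hΦ, ← besselLift_bessel, gradX_besselLift]
  obtain ⟨W, w0, w1, w2⟩ := exists_planeWave_sobolev k m Φ
  have key : ContinuousLinearMap.adjoint incl (mulOp (planeWave k m)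
      (f + (2 * k : ℂ) • DtBessel (bessel f) +
        (2 * m : ℂ) • DxBessel (bessel f) + (k ^ 2 + m ^ 2 : ℂ) • resolventLap f)) = W := by
    rw [adjoint_incl_eq_iff]
    intro V
    -- The equation for `Φ` is tested against `U`, the inverse wave times `V` (this is `i3`). In the
    -- first-order cross terms, `i1` and `i2` move the derivative from `U` to `Φ`, which doubles
    -- them.
    obtain ⟨U, u0, u1, u2⟩ := exists_planeWave_sobolev (-k) (-m) V
    have i1 := (weakDeriv_gradT Φ).inner_eq_neg isDirection_dirT (weakDeriv_gradT U)
    have i2 := (weakDeriv_gradX Φ).inner_eq_neg isDirection_dirX (weakDeriv_gradX U)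
    have i3 : ⟪U, Φ⟫_ℂ = ⟪incl U, f⟫_ℂ := ContinuousLinearMap.adjoint_inner_right _ _ _
    rw [sobolev_inner] at i3
    have v1 : mulOp (planeWave (-k) (-m)) (gradT V) = gradT U + (Complex.I * k) • incl U := by
      rw [u1, u0]
      push_cast
      module
    have v2 : mulOp (planeWave (-k) (-m)) (gradX V) =
        gradX U + (Complex.I * (m : ℝ)) • incl U := by
      rw [u2, u0]
      push_cast
      module
    rw [sobolev_inner, w0, w1, w2]
    simp only [inner_add_right, inner_smul_right, inner_planeWave_right, ← u0, v1, v2,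
      inner_add_left, inner_smul_left, map_mul, Complex.conj_I, Complex.conj_ofReal]
    rw [hΦ1] at i1 i3 ⊢
    rw [hΦ2] at i2 i3 ⊢
    rw [hΦ0] at i1 i2 i3 ⊢
    simp only [inner_smul_right] at i1 i2 i3 ⊢
    have hI := Complex.I_mul_I
    push_cast
    set A := ⟪incl U, DtBessel (bessel f)⟫_ℂ
    set B := ⟪incl U, DxBessel (bessel f)⟫_ℂ
    set P := ⟪gradT U, resolventLap f⟫_ℂ
    set Q := ⟪gradX U, resolventLap f⟫_ℂ
    set X := ⟪incl U, resolventLap f⟫_ℂ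
    linear_combination i3 + Complex.I * k * i1 + Complex.I * m * i2 -
      (k ^ 2 * X + m ^ 2 * X + 2 * k * A + 2 * m * B) * hI
  change _ = incl (ContinuousLinearMap.adjoint incl _)
  rw [key, w0, hΦ0]

/-! ## Wave packets -/

theorem re_inner_bessel_nonneg (z : HΩ) : 0 ≤ (⟪z, bessel z⟫_ℂ).re :=
  ((ContinuousLinearMap.nonneg_iff_isPositive _).1 bessel_nonneg).re_inner_nonneg_right z

/-- With `z = h - NΛh` one has `h - N²Λ²h = (1 + NΛ)z`, and `Λ ≥ 0` gives `‖(1 + NΛ)z‖ ≥ N‖Λz‖`.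
This passes from information on `Λ²` to information on its square root. -/
theorem mul_norm_bessel_sub_le (h : HΩ) {N : ℝ} (hN : 0 ≤ N) :
    N * ‖bessel h - (N : ℂ) • resolventLap h‖ ≤ ‖h - (N ^ 2 : ℂ) • resolventLap h‖ := by
  set z := h - (N : ℂ) • bessel h with hz
  have h1 : bessel z = bessel h - (N : ℂ) • resolventLap h := by
    rw [hz, map_sub, map_smul, bessel_bessel]
  have h2 : h - (N ^ 2 : ℂ) • resolventLap h = z + (N : ℂ) • bessel z := by
    rw [h1, hz]
    module
  rw [h2, ← h1]
  have h3 : ‖z + (N : ℂ) • bessel z‖ ^ 2 =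
      ‖z‖ ^ 2 + 2 * (N * (⟪z, bessel z⟫_ℂ).re) + (N * ‖bessel z‖) ^ 2 := by
    rw [@norm_add_sq ℂ, inner_smul_right, norm_smul, Complex.norm_real, Real.norm_of_nonneg hN]
    simp
  refine abs_le_of_sq_le_sq' ?_ (norm_nonneg _) |>.2
  rw [h3]
  have := mul_nonneg hN (re_inner_bessel_nonneg z)
  nlinarith [sq_nonneg ‖z‖]

/-- The frequency in `β` has to be an integer; rounding alters its square by `O(N)`, one order below
`N²`. -/
theorem abs_round_sq_sub_le {N ξ : ℝ} (hN : 1 ≤ N) (hξ : |ξ| ≤ 1) :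
    |((round (N * ξ) : ℤ) : ℝ)| ≤ 2 * N ∧
      |((round (N * ξ) : ℤ) : ℝ) ^ 2 - (N * ξ) ^ 2| ≤ 2 * N := by
  have h1 : |N * ξ - round (N * ξ)| ≤ 1 / 2 := abs_sub_round _
  have h2 : |N * ξ| ≤ N := by
    rw [abs_mul, abs_of_nonneg (by linarith)]
    nlinarith
  set m : ℝ := ((round (N * ξ) : ℤ) : ℝ)
  have h3 : |m| ≤ N + 1 / 2 := by
    have : m = N * ξ - (N * ξ - m) := by ring
    rw [this]
    exact (abs_sub _ _).trans (add_le_add h2 h1)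
  refine ⟨by linarith, ?_⟩
  have h4 : m ^ 2 - (N * ξ) ^ 2 = -(N * ξ - m) * (m + N * ξ) := by ring
  rw [h4, abs_mul, abs_neg]
  have h5 : |m + N * ξ| ≤ 2 * N + 1 / 2 := (abs_add_le _ _).trans (by linarith)
  nlinarith [abs_nonneg (N * ξ - m), abs_nonneg (m + N * ξ)]

/-- High frequency modulations of a function in the domain of `Δ` are approximate joint
eigenvectors of `Λ`, `DₜΛ` and `D_βΛ`. -/
theorem exists_wavePacket_bound (f : HΩ) {τ ξ : ℝ} (hw : τ ^ 2 + ξ ^ 2 = 1) :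
    ∃ C : ℝ, ∀ N : ℝ, 1 ≤ N →
      let u := mulOp (planeWave (N * τ) (round (N * ξ))) (resolventLap f)
      N * ‖bessel u‖ ≤ C ∧ N * ‖DtBessel u - (τ : ℂ) • u‖ ≤ C ∧
        N * ‖DxBessel u - (ξ : ℂ) • u‖ ≤ C := by
  set φ := resolventLap f with hφ
  set A₀ := ‖f‖
  set A₁ := ‖DtBessel (bessel f)‖ with hA1
  set A₂ := ‖DxBessel (bessel f)‖ with hA2
  set A₃ := ‖φ‖ with hA3
  have a0 : 0 ≤ A₀ := norm_nonneg _
  have a1 : 0 ≤ A₁ := norm_nonneg _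
  have a2 : 0 ≤ A₂ := norm_nonneg _
  have a3 : 0 ≤ A₃ := norm_nonneg _
  have hτ : |τ| ≤ 1 := abs_le_one_iff_mul_self_le_one.2 (by nlinarith [sq_nonneg ξ])
  have hξ : |ξ| ≤ 1 := abs_le_one_iff_mul_self_le_one.2 (by nlinarith [sq_nonneg τ])
  -- The coefficients bound `1`, `2|k|`, `2|m|` and `|m² - (Nξ)²|`, each divided by `N`.
  set B := A₀ + 2 * A₁ + 4 * A₂ + 2 * A₃ with hB
  refine ⟨A₁ + A₂ + A₃ + B, fun N hN => ?_⟩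
  have hN0 : 0 < N := by linarith
  set k := N * τ with hk
  set m := round (N * ξ) with hm
  intro u
  obtain ⟨hm1, hm2⟩ := abs_round_sq_sub_le hN hξ
  rw [← hm] at hm1 hm2
  have hk1 : |k| ≤ N := by
    rw [hk, abs_mul, abs_of_pos hN0]
    nlinarith
  set E := mulOp (planeWave k m) with hE
  have nE : ∀ v, ‖E v‖ = ‖v‖ := norm_mulOp_planeWave k m
  set h := E (f + (2 * k : ℂ) • DtBessel (bessel f) + (2 * m : ℂ) • DxBessel (bessel f) +
    (k ^ 2 + m ^ 2 : ℂ) • φ) with hh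
  have hu : u = resolventLap h := planeWave_resolventLap k m f
  have hr : ‖h - (N ^ 2 : ℂ) • u‖ ≤ N * B := by
    have e1 : h - (N ^ 2 : ℂ) • u = E (f + ((2 * k : ℝ) : ℂ) • DtBessel (bessel f) +
        ((2 * m : ℝ) : ℂ) • DxBessel (bessel f) + (((m : ℝ) ^ 2 - (N * ξ) ^ 2 : ℝ) : ℂ) • φ) := by
      -- Since `τ² + ξ² = 1`, the order `N²` part cancels and only the rounding error remains.
      have e2 : ((((m : ℝ) ^ 2 - (N * ξ) ^ 2 : ℝ) : ℂ)) = (k ^ 2 + m ^ 2 : ℂ) - (N ^ 2 : ℂ) := by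
        have : (m : ℝ) ^ 2 - (N * ξ) ^ 2 = k ^ 2 + (m : ℝ) ^ 2 - N ^ 2 := by
          rw [hk]
          linear_combination -(N ^ 2) * hw
        rw [this]
        push_cast
        rfl
      rw [e2]
      change h - (N ^ 2 : ℂ) • E φ = _
      rw [hh, ← map_smul E, ← map_sub E]
      congr 1
      push_cast
      module
    rw [e1, nE]
    refine (norm_add_le _ _).trans ((add_le_add (norm_add₃_le) le_rfl).trans ?_)
    rw [norm_smul, norm_smul, norm_smul, Complex.norm_real, Complex.norm_real, Complex.norm_real,
      Real.norm_eq_abs, Real.norm_eq_abs, Real.norm_eq_abs, abs_mul 2 k, abs_mul 2 (m : ℝ), abs_two]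
    have b1 : 2 * |k| * A₁ ≤ 2 * N * A₁ := by gcongr
    have b2 : 2 * |(m : ℝ)| * A₂ ≤ 2 * (2 * N) * A₂ := by gcongr
    have b3 : |(m : ℝ) ^ 2 - (N * ξ) ^ 2| * A₃ ≤ 2 * N * A₃ := by gcongr
    have b0 : A₀ ≤ N * A₀ := le_mul_of_one_le_left a0 hN
    rw [hB]
    linarith
  -- Here `u = Λg`, and `g` turns out to be `N u` up to a bounded error.
  set g := bessel h with hg
  have hgu : ‖g - (N : ℂ) • u‖ ≤ B := by
    have := mul_norm_bessel_sub_le h hN0.le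
    rw [← hu] at this
    exact le_of_mul_le_mul_left (this.trans hr) hN0
  obtain ⟨W, w0, w1, w2⟩ := exists_planeWave_sobolev k m (ContinuousLinearMap.adjoint incl f)
  have hW : besselLift g = W := by
    refine incl_injective ?_
    rw [incl_besselLift, hg, bessel_bessel, ← hu, w0]
    rfl
  have hΦ1 : gradT (ContinuousLinearMap.adjoint incl f) = Complex.I • DtBessel (bessel f) := by
    rw [← besselLift_bessel, gradT_besselLift]
  have hΦ2 : gradX (ContinuousLinearMap.adjoint incl f) = Complex.I • DxBessel (bessel f) := by
    rw [← besselLift_bessel, gradX_besselLift]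
  have hΦ0 : incl (ContinuousLinearMap.adjoint incl f) = φ := rfl
  rw [hΦ1, hΦ0] at w1
  rw [hΦ2, hΦ0] at w2
  rw [hΦ0] at w0
  -- The isometry lifts the estimate to `H¹(Ω)`; its three components yield the three bounds.
  have hQ : ‖besselLift (g - (N : ℂ) • u)‖ ≤ B := by rwa [norm_besselLift]
  have hQ' : besselLift (g - (N : ℂ) • u) = W - (N : ℂ) • besselLift u := by
    rw [map_sub, map_smul, hW]
  rw [hQ'] at hQ
  have nu : ‖u‖ = A₃ := nE φ
  have nN : ∀ v : HΩ, ‖(N : ℂ) • v‖ = N * ‖v‖ := fun v => by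
    rw [norm_smul, Complex.norm_real, Real.norm_of_nonneg hN0.le]
  refine ⟨?_, ?_, ?_⟩
  · have q := (norm_incl_le _).trans hQ
    rw [map_sub, map_smul, incl_besselLift, w0] at q
    rw [← nN]
    have e : (N : ℂ) • bessel u = u - (E φ - (N : ℂ) • bessel u) := by
      change _ = E φ - (E φ - _)
      module
    rw [e]
    refine (norm_sub_le _ _).trans ?_
    rw [nu]
    linarith
  · have q := (norm_gradT_le _).trans hQ
    rw [map_sub, map_smul, gradT_besselLift, w1] at q
    rw [← nN]
    have e : (N : ℂ) • (DtBessel u - (τ : ℂ) • u) = E (DtBessel (bessel f)) -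
        (-Complex.I) • (E (Complex.I • DtBessel (bessel f)) + (Complex.I * k) • E φ -
          (N : ℂ) • Complex.I • DtBessel u) := by
      change (N : ℂ) • (_ - (τ : ℂ) • E φ) = _
      have hI := Complex.I_mul_I
      rw [map_smul, hk]
      push_cast
      simp only [smul_add, smul_sub, smul_smul]
      rw [show -Complex.I * Complex.I = 1 by rw [neg_mul, hI, neg_neg],
        show -Complex.I * (Complex.I * (N * τ : ℂ)) = N * τ by linear_combination -(N * τ : ℂ) * hI,
        show -Complex.I * (N * Complex.I : ℂ) = N by linear_combination -(N : ℂ) * hI]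
      module
    rw [e]
    refine (norm_sub_le _ _).trans ?_
    rw [nE, norm_smul, norm_neg, Complex.norm_I, one_mul]
    linarith
  · have q := (norm_gradX_le _).trans hQ
    rw [map_sub, map_smul, gradX_besselLift, w2] at q
    rw [← nN]
    have e : (N : ℂ) • (DxBessel u - (ξ : ℂ) • u) = E (DxBessel (bessel f)) -
        (-Complex.I) • (E (Complex.I • DxBessel (bessel f)) + (Complex.I * (m : ℝ)) • E φ -
          (N : ℂ) • Complex.I • DxBessel u) - ((N * ξ - m : ℝ) : ℂ) • E φ := by
      change (N : ℂ) • (_ - (ξ : ℂ) • E φ) = _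
      have hI := Complex.I_mul_I
      rw [map_smul]
      push_cast
      simp only [smul_add, smul_sub, smul_smul]
      rw [show -Complex.I * Complex.I = 1 by rw [neg_mul, hI, neg_neg],
        show -Complex.I * (Complex.I * (m : ℂ)) = m by linear_combination -(m : ℂ) * hI,
        show -Complex.I * (N * Complex.I : ℂ) = N by linear_combination -(N : ℂ) * hI]
      module
    rw [e]
    refine (norm_sub_le _ _).trans ((add_le_add (norm_sub_le _ _) le_rfl).trans ?_)
    rw [nE, norm_smul, norm_neg, Complex.norm_I, one_mul, norm_smul, nE, Complex.norm_real,
      Real.norm_eq_abs]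
    -- Only the `β` component sees the rounding error, at most `1/2`.
    have b : |N * ξ - m| * A₃ ≤ 1 * A₃ := by
      gcongr
      exact (abs_sub_round _).trans (by norm_num)
    linarith

theorem exists_localized (z₀ : Cyl) {ε : ℝ} (hε : 0 < ε) :
    ∃ g : HΩ, ‖g‖ = 1 ∧ ∀ᵐ z, z ∉ Metric.ball z₀ ε → g z = 0 := by
  have hpos : (volume : Measure Cyl) (Metric.ball z₀ ε) ≠ 0 :=
    (Metric.isOpen_ball.measure_pos volume ⟨z₀, Metric.mem_ball_self hε⟩).ne'
  have hfin : (volume : Measure Cyl) (Metric.ball z₀ ε) ≠ ⊤ := by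
    have : (volume : Measure Cyl) (Metric.closedBall z₀ ε) < ⊤ :=
      (isCompact_closedBall z₀ ε).measure_lt_top
    exact ((measure_mono Metric.ball_subset_closedBall).trans_lt this).ne
  let v : HΩ := indicatorConstLp 2 Metric.isOpen_ball.measurableSet hfin (1 : ℂ)
  have hv : ‖v‖ ≠ 0 := by
    rw [norm_indicatorConstLp (by simp) (by simp), norm_one, one_mul]
    refine (Real.rpow_pos_of_pos ?_ _).ne'
    exact ENNReal.toReal_pos hpos hfin
  refine ⟨((‖v‖⁻¹ : ℝ) : ℂ) • v, ?_, ?_⟩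
  · rw [norm_smul, Complex.norm_real, norm_inv, norm_norm, inv_mul_cancel₀ hv]
  · filter_upwards [Lp.coeFn_smul ((‖v‖⁻¹ : ℝ) : ℂ) v,
      indicatorConstLp_coeFn_notMem (p := 2) (hs := Metric.isOpen_ball.measurableSet)
        (hμs := hfin) (c := (1 : ℂ))] with z h1 h2 hz
    rw [h1, Pi.smul_apply, h2 hz, smul_zero]

/-- Wave packets concentrating at a point of the cosphere bundle of the cylinder. -/
theorem exists_wavePackets (z₀ : Cyl) {τ ξ : ℝ} (hw : τ ^ 2 + ξ ^ 2 = 1) :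
    ∃ u : ℕ → HΩ, Tendsto (fun n => ‖u n‖) atTop (𝓝 1) ∧
      (∀ f : Cyl →ᵇ ℂ, Tendsto (fun n => mulOp f (u n) - f z₀ • u n) atTop (𝓝 0)) ∧
      Tendsto (fun n => bessel (u n)) atTop (𝓝 0) ∧
      Tendsto (fun n => DtBessel (u n) - (τ : ℂ) • u n) atTop (𝓝 0) ∧
      Tendsto (fun n => DxBessel (u n) - (ξ : ℂ) • u n) atTop (𝓝 0) := by
  let ε : ℕ → ℝ := fun n => 1 / (n + 1)
  have hε : ∀ n, 0 < ε n := fun n => by positivity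
  have hε0 : Tendsto ε atTop (𝓝 0) := tendsto_one_div_add_atTop_nhds_zero_nat
  choose g hg1 hg2 using fun n => exists_localized z₀ (hε n)
  -- The localized profile is replaced by a nearby one in the range of `(1 - Δ)⁻¹`, where
  -- `exists_wavePacket_bound` applies.
  have hf : ∀ n, ∃ f : HΩ, ‖resolventLap f - g n‖ ≤ ε n := fun n => by
    obtain ⟨f, hf⟩ := denseRange_resolventLap.exists_dist_lt (g n) (hε n)
    rw [dist_comm, dist_eq_norm] at hf
    exact ⟨f, hf.le⟩
  choose f hf using hf
  choose C hC using fun n => exists_wavePacket_bound (f n) hw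
  -- The frequency is chosen after the profile, large enough to beat its constant `C n`.
  have hN : ∀ n, ∃ N : ℝ, 1 ≤ N ∧ C n / N ≤ ε n := fun n => by
    refine ⟨max 1 (C n / ε n), le_max_left _ _, ?_⟩
    rw [div_le_iff₀ (by positivity), mul_comm, ← div_le_iff₀ (hε n)]
    exact le_max_right _ _
  choose N hN1 hNC using hN
  let φ : ℕ → HΩ := fun n => resolventLap (f n)
  let P : ℕ → Cyl →ᵇ ℂ := fun n => planeWave (N n * τ) (round (N n * ξ))
  have nP : ∀ n v, ‖mulOp (P n) v‖ = ‖v‖ := fun n v => norm_mulOp_planeWave _ _ v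
  have hb : ∀ n (x : HΩ), N n * ‖x‖ ≤ C n → ‖x‖ ≤ ε n := fun n x hx =>
    ((le_div_iff₀' (by linarith [hN1 n])).2 hx).trans (hNC n)
  refine ⟨fun n => mulOp (P n) (φ n), ?_, ?_, ?_, ?_, ?_⟩
  · simp only [nP]
    rw [tendsto_iff_dist_tendsto_zero]
    refine squeeze_zero (fun _ => dist_nonneg) (fun n => ?_) hε0
    rw [← hg1 n]
    exact (abs_norm_sub_norm_le _ _).trans (hf n)
  · intro F
    refine Metric.tendsto_atTop.2 fun δ hδ => ?_
    obtain ⟨η, hη, hF⟩ := Metric.continuous_iff.1 F.continuous z₀ (δ / 2) (by positivity)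
    have h1 : ∀ᶠ n in atTop, ε n < η := hε0.eventually (gt_mem_nhds hη)
    have h2 : ∀ᶠ n in atTop, 2 * ‖F‖ * ε n < δ / 2 := by
      have : Tendsto (fun n => 2 * ‖F‖ * ε n) atTop (𝓝 (2 * ‖F‖ * 0)) := hε0.const_mul _
      rw [mul_zero] at this
      exact this.eventually (gt_mem_nhds (by positivity))
    obtain ⟨n₀, hn₀⟩ := eventually_atTop.1 (h1.and h2)
    refine ⟨n₀, fun n hn => ?_⟩
    obtain ⟨k1, k2⟩ := hn₀ n hn
    -- Plane waves are isometric and commute with multiplications, so modulation does not disturb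
    -- localization.
    have e1 : mulOp F (mulOp (P n) (φ n)) - F z₀ • mulOp (P n) (φ n) =
        mulOp (P n) (mulOp F (φ n) - F z₀ • φ n) := by
      have : mulOp F * mulOp (P n) = mulOp (P n) * mulOp F := by
        rw [← mulOp_mul, ← mulOp_mul, mul_comm F]
      rw [map_sub, map_smul]
      congr 1
      exact congrArg (fun T : HΩ →L[ℂ] HΩ => T (φ n)) this
    have e2 : mulOp F (φ n) - F z₀ • φ n = (mulOp F (g n) - F z₀ • g n) +
        (mulOp F (φ n - g n) - F z₀ • (φ n - g n)) := by
      rw [map_sub]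
      module
    have e3 : ‖mulOp F (g n) - F z₀ • g n‖ ≤ δ / 2 * ‖g n‖ := by
      refine Lp.norm_le_mul_norm_of_ae_le_mul ?_
      filter_upwards [Lp.coeFn_sub (mulOp F (g n)) (F z₀ • g n), coeFn_mulOp F (g n),
        Lp.coeFn_smul (F z₀) (g n), hg2 n] with z q1 q2 q3 q4
      rw [q1, Pi.sub_apply, q2, q3, Pi.smul_apply, smul_eq_mul, ← sub_mul, norm_mul]
      by_cases hz : z ∈ Metric.ball z₀ (ε n)
      · refine mul_le_mul_of_nonneg_right ?_ (norm_nonneg _)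
        rw [← dist_eq_norm]
        exact (hF z ((Metric.mem_ball.1 hz).trans k1)).le
      · rw [q4 hz, norm_zero, mul_zero, mul_zero]
    have e4 : ‖mulOp F (φ n - g n) - F z₀ • (φ n - g n)‖ ≤ 2 * ‖F‖ * ε n := by
      refine (norm_sub_le _ _).trans ?_
      rw [norm_smul]
      have r1 := norm_mulOp_apply_le F (φ n - g n)
      have r2 := mul_le_mul_of_nonneg_right (F.norm_coe_le_norm z₀) (norm_nonneg (φ n - g n))
      have r3 := mul_le_mul_of_nonneg_left (hf n) (norm_nonneg F)
      linarith
    rw [dist_zero_right, e1, nP, e2]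
    refine (norm_add_le _ _).trans_lt ?_
    rw [hg1, mul_one] at e3
    linarith
  · exact squeeze_zero_norm (fun n => hb n _ (hC n (N n) (hN1 n)).1) hε0
  · exact squeeze_zero_norm (fun n => hb n _ (hC n (N n) (hN1 n)).2.1) hε0
  · exact squeeze_zero_norm (fun n => hb n _ (hC n (N n) (hN1 n)).2.2) hε0

/-! ## Characters from approximate joint eigenvectors -/

section ApproxEigen

variable {E : Type*} [NormedAddCommGroup E] [InnerProductSpace ℂ E]

/-- `u` is a sequence of approximate eigenvectors of `T` for the eigenvalue `c`. -/
def ApproxEigen (u : ℕ → E) (T : E →L[ℂ] E) (c : ℂ) : Prop :=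
  Tendsto (fun n => T (u n) - c • u n) atTop (𝓝 0)

variable {u : ℕ → E} {T S : E →L[ℂ] E} {c d : ℂ}

theorem ApproxEigen.add (hT : ApproxEigen u T c) (hS : ApproxEigen u S d) :
    ApproxEigen u (T + S) (c + d) := by
  have := Tendsto.add hT hS
  rw [add_zero] at this
  refine this.congr fun n => ?_
  rw [add_apply]
  module

theorem ApproxEigen.sub (hT : ApproxEigen u T c) (hS : ApproxEigen u S d) :
    ApproxEigen u (T - S) (c - d) := by
  have := Tendsto.sub hT hS
  rw [sub_zero] at this
  refine this.congr fun n => ?_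
  rw [sub_apply]
  module

theorem ApproxEigen.mul (hT : ApproxEigen u T c) (hS : ApproxEigen u S d) :
    ApproxEigen u (T * S) (c * d) := by
  have h1 := (T.continuous.tendsto 0).comp hS
  have h2 := Tendsto.add h1 (Tendsto.const_smul hT d)
  rw [map_zero, smul_zero, add_zero] at h2
  refine h2.congr fun n => ?_
  rw [mul_apply_eq_comp, Function.comp_apply, map_sub, map_smul]
  module

theorem approxEigen_algebraMap (u : ℕ → E) (c : ℂ) :
    ApproxEigen u (algebraMap ℂ (E →L[ℂ] E) c) c := by
  refine tendsto_const_nhds.congr fun n => ?_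
  rw [Algebra.algebraMap_eq_smul_one, smul_apply, one_apply_eq_self, sub_self]

/-- Applied to differences of operators, this gives uniqueness of eigenvalues and their convergence
along norm limits. -/
theorem ApproxEigen.norm_le (hu : Tendsto (fun n => ‖u n‖) atTop (𝓝 1))
    (hT : ApproxEigen u T c) : ‖c‖ ≤ ‖T‖ := by
  have h1 : Tendsto (fun n => ‖c‖ * ‖u n‖) atTop (𝓝 (‖c‖ * 1)) := hu.const_mul _
  have h2 : Tendsto (fun n => ‖T‖ * ‖u n‖ + ‖T (u n) - c • u n‖) atTop (𝓝 (‖T‖ * 1 + 0)) :=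
    (hu.const_mul _).add (tendsto_zero_iff_norm_tendsto_zero.1 hT)
  rw [mul_one] at h1
  rw [mul_one, add_zero] at h2
  refine le_of_tendsto_of_tendsto' h1 h2 fun n => ?_
  rw [← norm_smul]
  have h3 : c • u n = T (u n) - (T (u n) - c • u n) := by abel
  calc ‖c • u n‖ = ‖T (u n) - (T (u n) - c • u n)‖ := by rw [← h3]
    _ ≤ _ := (norm_sub_le _ _).trans (add_le_add (T.le_opNorm _) le_rfl)

theorem ApproxEigen.unique (hu : Tendsto (fun n => ‖u n‖) atTop (𝓝 1))
    (hT : ApproxEigen u T c) (hT' : ApproxEigen u T d) : c = d := by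
  have h := (hT.sub hT').norm_le hu
  rw [sub_self, norm_zero, norm_le_zero_iff, sub_eq_zero] at h
  exact h

theorem approxEigen_of_tendsto (hu : Tendsto (fun n => ‖u n‖) atTop (𝓝 1))
    {T' : ℕ → E →L[ℂ] E} {c' : ℕ → ℂ} (h : ∀ k, ApproxEigen u (T' k) (c' k))
    (hT : Tendsto T' atTop (𝓝 T)) (hc : Tendsto c' atTop (𝓝 c)) : ApproxEigen u T c := by
  refine Metric.tendsto_nhds.2 fun ε hε => ?_
  -- The factor `2` bounds `‖u n‖` for large `n`.
  have e1 : Tendsto (fun k => (‖T - T' k‖ + ‖c' k - c‖) * 2) atTop (𝓝 ((0 + 0) * 2)) := by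
    refine Tendsto.mul_const 2 (Tendsto.add ?_ (tendsto_iff_norm_sub_tendsto_zero.1 hc))
    simpa only [norm_sub_rev] using tendsto_iff_norm_sub_tendsto_zero.1 hT
  rw [add_zero, zero_mul] at e1
  obtain ⟨k, hk⟩ := (e1.eventually (gt_mem_nhds (half_pos hε))).exists
  filter_upwards [Metric.tendsto_nhds.1 (h k) (ε / 2) (half_pos hε),
    hu.eventually (gt_mem_nhds one_lt_two)] with n h1 h2
  rw [dist_zero_right] at h1 ⊢
  have e2 : T (u n) - c • u n =
      ((T - T' k) (u n) + (c' k - c) • u n) + (T' k (u n) - c' k • u n) := by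
    rw [sub_apply]
    module
  have h3 : ‖(T - T' k) (u n) + (c' k - c) • u n‖ ≤ (‖T - T' k‖ + ‖c' k - c‖) * 2 := by
    refine (norm_add_le _ _).trans ?_
    rw [norm_smul, add_mul]
    refine add_le_add (((T - T' k).le_opNorm _).trans ?_) ?_
    · exact mul_le_mul_of_nonneg_left h2.le (norm_nonneg _)
    · exact mul_le_mul_of_nonneg_left h2.le (norm_nonneg _)
  rw [e2]
  exact (norm_add_le _ _).trans_lt (by linarith)

variable [CompleteSpace E]

/-- The operators `T` such that `u` is a sequence of approximate eigenvectors of `T` and of its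
adjoint, for conjugate eigenvalues. -/
def approxEigenAlgebra (u : ℕ → E) : StarSubalgebra ℂ (E →L[ℂ] E) where
  carrier := {T | ∃ c, ApproxEigen u T c ∧ ApproxEigen u (star T) (star c)}
  mul_mem' := by
    rintro T S ⟨c, h1, h2⟩ ⟨d, h3, h4⟩
    refine ⟨c * d, h1.mul h3, ?_⟩
    rw [star_mul, star_mul]
    exact h4.mul h2
  add_mem' := by
    rintro T S ⟨c, h1, h2⟩ ⟨d, h3, h4⟩
    refine ⟨c + d, h1.add h3, ?_⟩
    rw [star_add, star_add]
    exact h2.add h4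
  algebraMap_mem' c := by
    refine ⟨c, approxEigen_algebraMap u c, ?_⟩
    rw [← algebraMap_star_comm]
    exact approxEigen_algebraMap u _
  star_mem' := by
    rintro T ⟨c, h1, h2⟩
    refine ⟨star c, h2, ?_⟩
    rwa [star_star, star_star]

theorem isClosed_approxEigenAlgebra (hu : Tendsto (fun n => ‖u n‖) atTop (𝓝 1)) :
    IsClosed (approxEigenAlgebra u : Set (E →L[ℂ] E)) := by
  refine isClosed_of_closure_subset fun T hT => ?_
  obtain ⟨T', hT', hlim⟩ := mem_closure_iff_seq_limit.1 hT
  choose c h1 h2 using hT'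
  have hc : CauchySeq c := by
    refine Metric.cauchySeq_iff.2 fun ε hε => ?_
    obtain ⟨N, hN⟩ := Metric.cauchySeq_iff.1 hlim.cauchySeq ε hε
    refine ⟨N, fun m hm n hn => lt_of_le_of_lt ?_ (hN m hm n hn)⟩
    rw [dist_eq_norm, dist_eq_norm]
    exact ((h1 m).sub (h1 n)).norm_le hu
  obtain ⟨d, hd⟩ := cauchySeq_tendsto_of_complete hc
  exact ⟨d, approxEigen_of_tendsto hu h1 hlim hd,
    approxEigen_of_tendsto hu h2 (hlim.star) (hd.star)⟩

/-- Approximate eigenvalues add and multiply with the operators; being unique, they form a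
homomorphism. -/
theorem exists_algHom_of_approxEigen (hu : Tendsto (fun n => ‖u n‖) atTop (𝓝 1))
    {B : StarSubalgebra ℂ (E →L[ℂ] E)} (hB : B ≤ approxEigenAlgebra u) :
    ∃ χ : B →ₐ[ℂ] ℂ, ∀ (T : B) (c : ℂ), ApproxEigen u T c → χ T = c := by
  have h : ∀ T : B, ∃ c, ApproxEigen u T c := fun T => (hB T.2).imp fun _ h => h.1
  choose χ hχ using h
  refine ⟨⟨⟨⟨⟨χ, ?_⟩, ?_⟩, ?_, ?_⟩, ?_⟩, fun T c hc => (hχ T).unique hu hc⟩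
  · refine (hχ 1).unique hu ?_
    simpa using approxEigen_algebraMap u 1
  · exact fun T S => (hχ (T * S)).unique hu ((hχ T).mul (hχ S))
  · refine (hχ 0).unique hu ?_
    simpa using approxEigen_algebraMap u 0
  · exact fun T S => (hχ (T + S)).unique hu ((hχ T).add (hχ S))
  · exact fun c => (hχ (algebraMap ℂ B c)).unique hu (approxEigen_algebraMap u c)

end ApproxEigen

/-! ## The symbol space as a space of characters -/

section SymbolSpace

variable {A : Type*} [NormedRing A] [NormedAlgebra ℂ A]

/-- The kernel of a character is a closed two-sided ideal, and it contains all commutators because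
`ℂ` is commutative. -/
theorem eq_zero_of_mem_commutatorIdeal (χ : characterSpace ℂ A) {a : A}
    (ha : a ∈ commutatorIdeal A) : χ a = 0 := by
  have h1 : TwoSidedIdeal.span {c : A | ∃ a b : A, c = a * b - b * a} ≤
      TwoSidedIdeal.ker (CharacterSpace.toAlgHom χ) := by
    rw [TwoSidedIdeal.span_le]
    rintro _ ⟨a, b, rfl⟩
    change _ ∈ TwoSidedIdeal.ker _
    rw [TwoSidedIdeal.mem_ker]
    change χ (a * b - b * a) = 0
    rw [map_sub, map_mul, map_mul, mul_comm, sub_self]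
  have h2 : IsClosed {a : A | χ a = 0} := isClosed_eq (map_continuous χ) continuous_const
  refine closure_minimal (fun a ha => ?_) h2 ha
  exact (TwoSidedIdeal.mem_ker _).1 (h1 ha)

theorem exists_symbolSpace (χ : characterSpace ℂ A) :
    ∃ ψ : SymbolSpace A, ∀ a, ψ (Ideal.Quotient.mkₐ ℂ (commutatorIdeal A) a) = χ a := by
  let L : CommQuotient A →ₐ[ℂ] ℂ := Ideal.Quotient.liftₐ (commutatorIdeal A)
    (CharacterSpace.toAlgHom χ) fun a ha => eq_zero_of_mem_commutatorIdeal χ ha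
  have hL : ∀ a, L (Ideal.Quotient.mkₐ ℂ (commutatorIdeal A) a) = χ a := fun a => rfl
  have hc : Continuous L := by
    refine (isQuotientMap_quot_mk).continuous_iff.2 ?_
    exact map_continuous χ
  let M : WeakDual ℂ (CommQuotient A) := (⟨L.toLinearMap, hc⟩ : CommQuotient A →L[ℂ] ℂ)
  refine ⟨⟨M, ?_, fun x y => map_mul L x y⟩, hL⟩
  intro h
  have h1 : L 1 = 0 := congrArg (fun T : WeakDual ℂ (CommQuotient A) => T 1) h
  rw [map_one] at h1
  exact one_ne_zero h1

variable [CompleteSpace A]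

/-- The character of an algebra given by a point of its symbol space. -/
def toCharacter (χ : SymbolSpace A) : characterSpace ℂ A :=
  CharacterSpace.equivAlgHom.symm
    ((CharacterSpace.toAlgHom χ).comp (Ideal.Quotient.mkₐ ℂ (commutatorIdeal A)))

theorem continuous_toCharacter : Continuous (toCharacter (A := A)) := by
  refine continuous_induced_rng.2 (WeakDual.continuous_of_continuous_eval fun a => ?_)
  exact (WeakDual.eval_continuous (Ideal.Quotient.mkₐ ℂ (commutatorIdeal A) a)).comp
    continuous_subtype_val

theorem toCharacter_bijective : Function.Bijective (toCharacter (A := A)) := by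
  constructor
  · intro χ ψ h
    refine CharacterSpace.ext fun q => ?_
    obtain ⟨a, rfl⟩ := Ideal.Quotient.mk_surjective q
    exact congrArg (fun χ : characterSpace ℂ A => χ a) h
  · intro χ
    obtain ⟨ψ, hψ⟩ := exists_symbolSpace χ
    exact ⟨ψ, CharacterSpace.ext fun a => hψ a⟩

/-- The symbol space of a Banach algebra is its space of characters. -/
def symbolSpaceHomeomorph : SymbolSpace A ≃ₜ characterSpace ℂ A where
  toEquiv := Equiv.ofBijective toCharacter toCharacter_bijective
  continuous_toFun := continuous_toCharacter
  continuous_invFun := by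
    refine continuous_induced_rng.2 (WeakDual.continuous_of_continuous_eval fun q => ?_)
    obtain ⟨a, rfl⟩ := Ideal.Quotient.mk_surjective q
    have h : Continuous fun χ : characterSpace ℂ A => χ a :=
      (WeakDual.eval_continuous a).comp continuous_subtype_val
    refine h.congr fun χ => ?_
    have h2 := (Equiv.ofBijective toCharacter toCharacter_bijective).apply_symm_apply χ
    exact congrArg (fun χ : characterSpace ℂ A => χ a) h2.symm

theorem symbolSpaceHomeomorph_apply (χ : SymbolSpace A) (a : A) :
    symbolSpaceHomeomorph χ a = symbol A a χ := rfl

/-- Composition of characters with a homomorphism of algebras. -/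
def compCharacter {B : Type*} [NormedRing B] [NormedAlgebra ℂ B] [CompleteSpace B]
    (f : A →ₐ[ℂ] B) : C(characterSpace ℂ B, characterSpace ℂ A) where
  toFun χ := CharacterSpace.equivAlgHom.symm ((CharacterSpace.toAlgHom χ).comp f)
  continuous_toFun := continuous_induced_rng.2 (WeakDual.continuous_of_continuous_eval fun a =>
    (WeakDual.eval_continuous (f a)).comp continuous_subtype_val)

theorem compCharacter_apply {B : Type*} [NormedRing B] [NormedAlgebra ℂ B] [CompleteSpace B]
    (f : A →ₐ[ℂ] B) (χ : characterSpace ℂ B) (a : A) : compCharacter f χ a = χ (f a) := rfl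

end SymbolSpace

/-! ## Characters of `𝒜†` and `𝒜◇` -/

theorem isClosed_aDagger : IsClosed (ADagger : Set (HΩ →L[ℂ] HΩ)) :=
  StarSubalgebra.isClosed_topologicalClosure _

theorem isClosed_aDiamond : IsClosed (ADiamond : Set (HΩ →L[ℂ] HΩ)) :=
  StarSubalgebra.isClosed_topologicalClosure _

instance : CompleteSpace ADagger := isClosed_aDagger.completeSpace_coe

instance : CompleteSpace ADiamond := isClosed_aDiamond.completeSpace_coe

/-- Closedness makes `B` a C*-algebra, where characters preserve the star automatically. -/
theorem character_star {B : StarSubalgebra ℂ (HΩ →L[ℂ] HΩ)}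
    (hB : IsClosed (B : Set (HΩ →L[ℂ] HΩ))) (χ : characterSpace ℂ B) (T : B) :
    χ (star T) = star (χ T) :=
  letI : CStarAlgebra B := StarSubalgebra.cstarAlgebra B (h_closed := hB)
  map_star (F := B →ₐ[ℂ] ℂ) (CharacterSpace.toAlgHom χ) T

theorem aDagger_character_star (χ : characterSpace ℂ ADagger) (T : ADagger) :
    χ (star T) = star (χ T) := character_star isClosed_aDagger χ T

theorem aDiamond_character_star (χ : characterSpace ℂ ADiamond) (T : ADiamond) :
    χ (star T) = star (χ T) := character_star isClosed_aDiamond χ T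

/-! ### Smooth multiplications and the unitaries `e^{inβ}`, `e^{ijt}` -/

theorem smoothS1_fourier (n : ℤ) : SmoothS1 (fourier n) := by
  unfold SmoothS1
  simp only [fourier_coe_apply]
  exact ((contDiff_const.mul Complex.ofRealCLM.contDiff).div_const _).cexp

theorem SmoothS1.add {a b : C(S1, ℂ)} (ha : SmoothS1 a) (hb : SmoothS1 b) : SmoothS1 (a + b) :=
  ContDiff.add ha hb

theorem SmoothS1.smul {a : C(S1, ℂ)} (c : ℂ) (ha : SmoothS1 a) : SmoothS1 (c • a) :=
  ContDiff.const_smul c ha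

theorem mulX_add {a b : C(S1, ℂ)} (ha : SmoothS1 a) (hb : SmoothS1 b) :
    mulX (a + b) (ha.add hb) = mulX a ha + mulX b hb :=
  Subtype.ext (mulOp_add (liftX a) (liftX b))

theorem mulX_smul {a : C(S1, ℂ)} (c : ℂ) (ha : SmoothS1 a) :
    mulX (c • a) (ha.smul c) = c • mulX a ha :=
  Subtype.ext (mulOp_smul c (liftX a))

theorem smoothS1_zero : SmoothS1 0 := contDiff_const

theorem mulX_zero : mulX 0 smoothS1_zero = 0 := Subtype.ext (by
  change mulOp (liftX 0) = 0
  have h0 : liftX 0 = (0 : ℂ) • liftX 0 := by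
    ext z
    simp [liftX]
  rw [h0, mulOp_smul, zero_smul])

theorem norm_mulX_sub_le {a b : C(S1, ℂ)} (ha : SmoothS1 a) (hb : SmoothS1 b) :
    ‖mulX a ha - mulX b hb‖ ≤ ‖a - b‖ := by
  refine ContinuousLinearMap.opNorm_le_bound _ (norm_nonneg _) fun v => ?_
  change ‖mulOp (liftX a) v - mulOp (liftX b) v‖ ≤ _
  have h : liftX a = liftX (a - b) + liftX b := by
    ext z
    simp [liftX]
  rw [h, mulOp_add, add_apply, add_sub_cancel_right]
  refine (norm_mulOp_apply_le _ _).trans (mul_le_mul_of_nonneg_right ?_ (norm_nonneg _))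
  exact (BoundedContinuousFunction.norm_le (norm_nonneg _)).2 fun z =>
    (a - b).norm_coe_le_norm z.2

theorem liftX_fourier (n : ℤ) : liftX (fourier n) = planeWave 0 n := by
  ext z
  simp [planeWave_apply, liftX]

theorem expT_eq (j : ℤ) : expT j = planeWave j 0 := by
  ext z
  simp [planeWave_apply, expT]

/-- Multiplication by `e^{inβ}` as an element of `𝒜†`. -/
def unitX (n : ℤ) : ADagger := mulX (fourier n) (smoothS1_fourier n)

theorem coe_unitX (n : ℤ) : (unitX n : HΩ →L[ℂ] HΩ) = mulOp (planeWave 0 n) :=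
  congrArg mulOp (liftX_fourier n)

theorem coe_mulExp (j : ℤ) : (mulExp j : HΩ →L[ℂ] HΩ) = mulOp (planeWave j 0) :=
  congrArg mulOp (expT_eq j)

theorem unitX_zero : unitX 0 = 1 :=
  Subtype.ext (by rw [coe_unitX, planeWave_zero, mulOp_one]; rfl)

theorem unitX_add (m n : ℤ) : unitX (m + n) = unitX m * unitX n :=
  Subtype.ext (by
    change _ = (unitX m : HΩ →L[ℂ] HΩ) * (unitX n : HΩ →L[ℂ] HΩ)
    rw [coe_unitX, coe_unitX, coe_unitX, ← mulOp_mul, ← planeWave_add, add_zero])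

theorem star_unitX (n : ℤ) : star (unitX n) = unitX (-n) :=
  Subtype.ext (by
    change star (unitX n : HΩ →L[ℂ] HΩ) = _
    rw [coe_unitX, coe_unitX, star_mulOp, star_planeWave, neg_zero])

theorem mulExp_zero : mulExp 0 = 1 :=
  Subtype.ext (by rw [coe_mulExp, Int.cast_zero, planeWave_zero, mulOp_one]; rfl)

theorem mulExp_add (m n : ℤ) : mulExp (m + n) = mulExp m * mulExp n :=
  Subtype.ext (by
    change _ = (mulExp m : HΩ →L[ℂ] HΩ) * (mulExp n : HΩ →L[ℂ] HΩ)
    rw [coe_mulExp, coe_mulExp, coe_mulExp, ← mulOp_mul, ← planeWave_add, add_zero, Int.cast_add])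

theorem star_mulExp (n : ℤ) : star (mulExp n) = mulExp (-n) :=
  Subtype.ext (by
    change star (mulExp n : HΩ →L[ℂ] HΩ) = _
    rw [coe_mulExp, coe_mulExp, star_mulOp, star_planeWave, neg_zero, Int.cast_neg])

theorem eq_zpow_of_map_add {F : ℤ → ℂ} (h0 : F 0 = 1) (h : ∀ m n, F (m + n) = F m * F n)
    (n : ℤ) : F n = F 1 ^ n := by
  have h1 : F 1 ≠ 0 := by
    intro h1
    have := h 1 (-1)
    rw [add_neg_cancel, h0, h1, zero_mul] at this
    exact one_ne_zero this
  have key : ∀ n, F (n + 1) = F n * F 1 := fun n => h n 1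
  induction n using Int.induction_on with
  | zero => rw [h0, zpow_zero]
  | succ i hi => rw [key, hi, zpow_add_one₀ h1]
  | pred i hi =>
    have := key (-(i : ℤ) - 1)
    rw [sub_add_cancel, hi] at this
    rw [zpow_sub_one₀ h1, this, mul_inv_cancel_right₀ h1]

/-! ### Values of characters on the generators -/

theorem character_unitX (χ : characterSpace ℂ ADagger) (n : ℤ) : χ (unitX n) = χ (unitX 1) ^ n :=
  eq_zpow_of_map_add (F := fun n => χ (unitX n)) (by rw [unitX_zero, map_one])
    (fun m n => by rw [unitX_add, map_mul]) n

theorem character_mulExp (χ : characterSpace ℂ ADiamond) (n : ℤ) :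
    χ (mulExp n) = χ (mulExp 1) ^ n :=
  eq_zpow_of_map_add (F := fun n => χ (mulExp n)) (by rw [mulExp_zero, map_one])
    (fun m n => by rw [mulExp_add, map_mul]) n

theorem norm_eq_one_of_star_mul {z w : ℂ} (h : w = star z) (h1 : w * z = 1) : ‖z‖ = 1 := by
  have h2 : ‖z‖ * ‖z‖ = 1 := by
    have h3 : ‖w‖ = ‖z‖ := by rw [h, norm_star]
    rw [← norm_one (α := ℂ), ← h1, norm_mul, h3]
  nlinarith [norm_nonneg z]

theorem norm_character_unitX (χ : characterSpace ℂ ADagger) : ‖χ (unitX 1)‖ = 1 :=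
  norm_eq_one_of_star_mul (aDagger_character_star χ _)
    (by rw [star_unitX, ← map_mul, ← unitX_add, neg_add_cancel, unitX_zero, map_one])

theorem norm_character_mulExp (χ : characterSpace ℂ ADiamond) : ‖χ (mulExp 1)‖ = 1 :=
  norm_eq_one_of_star_mul (aDiamond_character_star χ _)
    (by rw [star_mulExp, ← map_mul, ← mulExp_add, neg_add_cancel, mulExp_zero, map_one])

theorem unitX_mul_genΛ_sq (n : ℤ) : unitX n * (genΛ * genΛ) = (genΛ * genΛ) *
    (unitX n * (1 + (2 * n : ℂ) • (genDx * genΛ) + (n ^ 2 : ℂ) • (genΛ * genΛ))) := by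
  refine Subtype.ext (ContinuousLinearMap.ext fun f => ?_)
  change (unitX n : HΩ →L[ℂ] HΩ) (bessel (bessel f)) = bessel (bessel
    ((unitX n : HΩ →L[ℂ] HΩ) (f + (2 * n : ℂ) • DxBessel (bessel f) +
      (n ^ 2 : ℂ) • bessel (bessel f))))
  have h := planeWave_resolventLap 0 n f
  rw [bessel_bessel, bessel_bessel, coe_unitX, h]
  congr 2
  push_cast
  module

/-- Apply `χ` to `unitX_mul_genΛ_sq` and cancel the nonzero value of `unitX n`. With `λ = χ(Λ)` and
`δ = χ(D_βΛ)` this leaves `λ²(2nδλ + n²λ²) = 0`; adding the cases `n = 1` and `n = -1` gives `2λ⁴ =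
0`. -/
theorem character_genΛ (χ : characterSpace ℂ ADagger) : χ genΛ = 0 := by
  have key : ∀ n : ℤ, χ genΛ * χ genΛ *
      (2 * n * (χ genDx * χ genΛ) + n ^ 2 * (χ genΛ * χ genΛ)) = 0 := by
    intro n
    have h := congrArg χ (unitX_mul_genΛ_sq n)
    simp only [map_mul, map_add, map_smul, map_one, smul_eq_mul] at h
    have h0 : χ (unitX n) ≠ 0 := by
      rw [character_unitX]
      refine zpow_ne_zero _ fun h => ?_
      have := norm_character_unitX χ
      rw [h, norm_zero] at this
      exact zero_ne_one this
    refine mul_left_cancel₀ h0 ?_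
    linear_combination -h
  have h1 := key 1
  have h2 := key (-1)
  push_cast at h1 h2
  have h3 : χ genΛ ^ 4 = 0 := by linear_combination (h1 + h2) / 2
  exact pow_eq_zero_iff (by norm_num) |>.1 h3

theorem star_genDt : star genDt = genDt := Subtype.ext isSelfAdjoint_DtBessel

theorem star_genDx : star genDx = genDx := Subtype.ext isSelfAdjoint_DxBessel

theorem character_genDt_re (χ : characterSpace ℂ ADagger) : ((χ genDt).re : ℂ) = χ genDt := by
  have h := aDagger_character_star χ genDt
  rw [star_genDt] at h
  exact Complex.conj_eq_iff_re.1 h.symm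

theorem character_genDx_re (χ : characterSpace ℂ ADagger) : ((χ genDx).re : ℂ) = χ genDx := by
  have h := aDagger_character_star χ genDx
  rw [star_genDx] at h
  exact Complex.conj_eq_iff_re.1 h.symm

theorem character_sq_add (χ : characterSpace ℂ ADagger) :
    (χ genDt).re ^ 2 + (χ genDx).re ^ 2 = 1 := by
  have h : genΛ * genΛ + genDt * genDt + genDx * genDx = 1 := Subtype.ext bessel_sq_add
  have h1 := congrArg χ h
  rw [map_add, map_add, map_mul, map_mul, map_mul, character_genΛ, map_one,
    ← character_genDt_re, ← character_genDx_re] at h1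
  have h2 : (((χ genDt).re ^ 2 + (χ genDx).re ^ 2 : ℝ) : ℂ) = (1 : ℝ) := by
    push_cast
    linear_combination h1
  exact_mod_cast h2

/-- The base point of a character of `𝒜†`. -/
def basePoint (χ : characterSpace ℂ ADagger) : S1 :=
  (AddCircle.homeomorphCircle Real.two_pi_pos.ne').symm
    ⟨χ (unitX 1), mem_sphere_zero_iff_norm.2 (norm_character_unitX χ)⟩

theorem fourier_basePoint (χ : characterSpace ℂ ADagger) (n : ℤ) :
    fourier n (basePoint χ) = χ (unitX n) := by
  have h : AddCircle.toCircle (basePoint χ) =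
      ⟨χ (unitX 1), mem_sphere_zero_iff_norm.2 (norm_character_unitX χ)⟩ := by
    rw [← AddCircle.homeomorphCircle_apply Real.two_pi_pos.ne']
    exact (AddCircle.homeomorphCircle Real.two_pi_pos.ne').apply_symm_apply _
  rw [fourier_apply, AddCircle.toCircle_zsmul, h, character_unitX χ n]
  rfl

/-- The direction of a character of `𝒜†`. -/
def codirection (χ : characterSpace ℂ ADagger) : Circle :=
  ⟨⟨(χ genDt).re, (χ genDx).re⟩, mem_sphere_zero_iff_norm.2 (by
    have h := character_sq_add χ
    rw [← sq_eq_sq₀ (norm_nonneg _) zero_le_one, ← Complex.normSq_eq_norm_sq, Complex.normSq_mk]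
    linarith)⟩

theorem continuous_eval_aDagger (T : ADagger) :
    Continuous fun χ : characterSpace ℂ ADagger => χ T :=
  (WeakDual.eval_continuous T).comp continuous_subtype_val

theorem continuous_eval_aDiamond (T : ADiamond) :
    Continuous fun χ : characterSpace ℂ ADiamond => χ T :=
  (WeakDual.eval_continuous T).comp continuous_subtype_val

theorem continuous_basePoint : Continuous basePoint :=
  (Homeomorph.continuous _).comp ((continuous_eval_aDagger _).subtype_mk _)

theorem continuous_codirection : Continuous codirection := by
  refine Continuous.subtype_mk ?_ _
  have h1 := Complex.continuous_re.comp (continuous_eval_aDagger genDt)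
  have h2 := Complex.continuous_re.comp (continuous_eval_aDagger genDx)
  exact Complex.equivRealProdCLM.symm.continuous.comp (h1.prodMk h2)

theorem norm_character_le (χ : characterSpace ℂ ADagger) (T : ADagger) : ‖χ T‖ ≤ ‖T‖ := by
  refine (AlgHom.norm_apply_le_self_mul_norm_one (CharacterSpace.toAlgHom χ) T).trans ?_
  exact mul_le_of_le_one_right (norm_nonneg T) ContinuousLinearMap.norm_id_le

/-- Both sides are contractions in `a` for the sup norm and agree on trigonometric polynomials,
which are dense. -/
theorem character_mulX (χ : characterSpace ℂ ADagger) (a : C(S1, ℂ)) (ha : SmoothS1 a) :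
    χ (mulX a ha) = a (basePoint χ) := by
  have h1 : ∀ p ∈ Submodule.span ℂ (Set.range (fourier (T := 2 * Real.pi))),
      ∃ hp : SmoothS1 p, χ (mulX p hp) = p (basePoint χ) := by
    intro p hp
    induction hp using Submodule.span_induction with
    | mem x hx =>
      obtain ⟨n, rfl⟩ := hx
      exact ⟨smoothS1_fourier n, (fourier_basePoint χ n).symm⟩
    | zero =>
      refine ⟨smoothS1_zero, ?_⟩
      rw [mulX_zero, map_zero]
      rfl
    | add p q _ _ hp hq =>
      obtain ⟨hp, hp'⟩ := hp
      obtain ⟨hq, hq'⟩ := hq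
      refine ⟨hp.add hq, ?_⟩
      rw [mulX_add hp hq, map_add, hp', hq']
      rfl
    | smul c p _ hp =>
      obtain ⟨hp, hp'⟩ := hp
      refine ⟨hp.smul c, ?_⟩
      rw [mulX_smul c hp, map_smul, hp']
      rfl
  refine eq_of_forall_dist_le fun ε hε => ?_
  have h2 : a ∈ closure
      ((Submodule.span ℂ (Set.range (fourier (T := 2 * Real.pi))) : Submodule ℂ C(S1, ℂ)) :
        Set C(S1, ℂ)) := by
    rw [← Submodule.topologicalClosure_coe, span_fourier_closure_eq_top]
    trivial
  obtain ⟨p, hp, hap⟩ := Metric.mem_closure_iff.1 h2 (ε / 2) (half_pos hε)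
  obtain ⟨hps, hpx⟩ := h1 p hp
  have h3 : dist (a (basePoint χ)) (p (basePoint χ)) ≤ ε / 2 :=
    (ContinuousMap.dist_apply_le_dist _).trans hap.le
  rw [dist_eq_norm] at hap
  have h4 : ‖mulX a ha - mulX p hps‖ ≤ ε / 2 := (norm_mulX_sub_le ha hps).trans hap.le
  have h6 : ‖χ (mulX a ha - mulX p hps)‖ ≤ ε / 2 :=
    (norm_character_le χ _).trans h4
  rw [map_sub, hpx, ← dist_eq_norm] at h6
  rw [dist_comm] at h3
  exact (dist_triangle _ _ _).trans (by linarith)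

/-- The point of `𝕊¹ × S¹_∞` given by a character of `𝒜†`. -/
def daggerMap (χ : characterSpace ℂ ADagger) : S1 × Circle := (basePoint χ, codirection χ)

/-! ### Characters are determined by the generators, and all points occur -/

theorem character_ext_of_adjoin {s : Set (HΩ →L[ℂ] HΩ)}
    (χ ψ : (StarAlgebra.adjoin ℂ s).topologicalClosure →ₐ[ℂ] ℂ)
    (hχ : Continuous χ) (hψ : Continuous ψ)
    (hχs : ∀ T, χ (star T) = star (χ T)) (hψs : ∀ T, ψ (star T) = star (ψ T))
    (h : ∀ (T : HΩ →L[ℂ] HΩ) (hT : T ∈ s),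
      χ ⟨T, StarSubalgebra.le_topologicalClosure _ (StarAlgebra.subset_adjoin ℂ s hT)⟩ =
      ψ ⟨T, StarSubalgebra.le_topologicalClosure _ (StarAlgebra.subset_adjoin ℂ s hT)⟩) :
    χ = ψ := by
  let χ' : (StarAlgebra.adjoin ℂ s).topologicalClosure →⋆ₐ[ℂ] ℂ := ⟨χ, hχs⟩
  let ψ' : (StarAlgebra.adjoin ℂ s).topologicalClosure →⋆ₐ[ℂ] ℂ := ⟨ψ, hψs⟩
  have key : χ' = ψ' := by
    refine StarAlgHom.ext_topologicalClosure hχ hψ ?_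
    refine StarAlgHom.ext_adjoin fun T hT => ?_
    exact h T hT
  exact congrArg StarAlgHom.toAlgHom key

theorem daggerMap_injective : Function.Injective daggerMap := by
  intro χ ψ h
  have h1 : basePoint χ = basePoint ψ := congrArg Prod.fst h
  have h2 : (codirection χ : ℂ) = codirection ψ :=
    congrArg (fun p : S1 × Circle => (p.2 : ℂ)) h
  refine CharacterSpace.equivAlgHom.injective ?_
  refine character_ext_of_adjoin (s := gensDagger) _ _ (map_continuous χ) (map_continuous ψ)
    (aDagger_character_star χ) (aDagger_character_star ψ) ?_
  rintro T (⟨a, ha, rfl⟩ | rfl | rfl | rfl)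
  · change χ (mulX a ha) = ψ (mulX a ha)
    rw [character_mulX, character_mulX, h1]
  · change χ genΛ = ψ genΛ
    rw [character_genΛ, character_genΛ]
  · change χ genDt = ψ genDt
    rw [← character_genDt_re χ, ← character_genDt_re ψ]
    have h3 := congrArg (fun z : ℂ => (z.re : ℂ)) h2
    exact h3
  · change χ genDx = ψ genDx
    rw [← character_genDx_re χ, ← character_genDx_re ψ]
    have h3 := congrArg (fun z : ℂ => (z.im : ℂ)) h2
    exact h3

/-- The limiting eigenvalue on wave packets at `z₀` with frequency direction `w`. Self-adjoint
generators have real eigenvalues, so the adjoint condition in `approxEigenAlgebra` costs nothing. -/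
theorem exists_character (z₀ : Cyl) (w : Circle) : ∃ χ : characterSpace ℂ ADiamond,
    (∀ (f : Cyl →ᵇ ℂ) (hf : mulOp f ∈ ADiamond), χ ⟨mulOp f, hf⟩ = f z₀) ∧
    χ (toDiamond genDt) = ((w : ℂ).re : ℂ) ∧ χ (toDiamond genDx) = ((w : ℂ).im : ℂ) := by
  have hw : (w : ℂ).re ^ 2 + (w : ℂ).im ^ 2 = 1 := by
    have := Circle.normSq_coe w
    rw [Complex.normSq_apply] at this
    linarith
  obtain ⟨u, hu, hm, h0, ht, hx⟩ := exists_wavePackets z₀ hw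
  have hm' : ∀ f : Cyl →ᵇ ℂ, mulOp f ∈ approxEigenAlgebra u := fun f =>
    ⟨f z₀, hm f, by
      rw [star_mulOp]
      exact hm (star f)⟩
  have hS : ∀ {T : HΩ →L[ℂ] HΩ} {c : ℝ}, IsSelfAdjoint T → ApproxEigen u T c →
      T ∈ approxEigenAlgebra u := fun {T c} hT h => ⟨c, h, by
    rw [hT.star_eq, ← starRingEnd_apply, Complex.conj_ofReal]
    exact h⟩
  have h0' : ApproxEigen u bessel ((0 : ℝ) : ℂ) := by
    refine h0.congr fun n => ?_
    rw [Complex.ofReal_zero, zero_smul, sub_zero]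
  have hd : ADagger ≤ approxEigenAlgebra u := by
    refine StarSubalgebra.topologicalClosure_minimal (StarAlgebra.adjoin_le ?_)
      (isClosed_approxEigenAlgebra hu)
    rintro T (⟨a, ha, rfl⟩ | rfl | rfl | rfl)
    · exact hm' _
    · exact hS isSelfAdjoint_bessel h0'
    · exact hS isSelfAdjoint_DtBessel ht
    · exact hS isSelfAdjoint_DxBessel hx
  have hD : ADiamond ≤ approxEigenAlgebra u := by
    refine StarSubalgebra.topologicalClosure_minimal (StarAlgebra.adjoin_le ?_)
      (isClosed_approxEigenAlgebra hu)
    rintro T (hT | ⟨j, rfl⟩)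
    · exact hd hT
    · exact hm' _
  obtain ⟨χ, hχ⟩ := exists_algHom_of_approxEigen hu hD
  exact ⟨CharacterSpace.equivAlgHom.symm χ, fun f hf => hχ _ _ (hm f), hχ _ _ ht, hχ _ _ hx⟩

/-- Restriction of characters from `𝒜◇` to `𝒜†`. -/
def restrictDagger : C(characterSpace ℂ ADiamond, characterSpace ℂ ADagger) :=
  compCharacter (StarSubalgebra.inclusion aDagger_le_aDiamond).toAlgHom

theorem inclusion_eq_toDiamond (T : ADagger) :
    (StarSubalgebra.inclusion aDagger_le_aDiamond).toAlgHom T = toDiamond T :=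
  Subtype.ext rfl

theorem restrictDagger_apply (χ : characterSpace ℂ ADiamond) (T : ADagger) :
    restrictDagger χ T = χ (toDiamond T) :=
  (compCharacter_apply (StarSubalgebra.inclusion aDagger_le_aDiamond).toAlgHom χ T).trans
    (congrArg χ (inclusion_eq_toDiamond T))

theorem symbol_toDiamond {χ : SymbolSpace ADiamond} {ψ : SymbolSpace ADagger}
    (h : restrictDagger (symbolSpaceHomeomorph χ) = symbolSpaceHomeomorph ψ) (T : ADagger) :
    symbol ADiamond (toDiamond T) χ = symbol ADagger T ψ := by
  have h1 := restrictDagger_apply (symbolSpaceHomeomorph χ) T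
  rw [h] at h1
  exact h1.symm

/-- The point of `S¹ × 𝕊¹ × S¹_∞` given by a character of `𝒜◇`. -/
def diamondMap (χ : characterSpace ℂ ADiamond) : Circle × S1 × Circle :=
  (⟨χ (mulExp 1), mem_sphere_zero_iff_norm.2 (norm_character_mulExp χ)⟩,
    daggerMap (restrictDagger χ))

theorem diamondMap_injective : Function.Injective diamondMap := by
  intro χ ψ h
  have h1 : χ (mulExp 1) = ψ (mulExp 1) :=
    congrArg (fun p : Circle × S1 × Circle => (p.1 : ℂ)) h
  have h2 : restrictDagger χ = restrictDagger ψ := daggerMap_injective (congrArg Prod.snd h)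
  refine CharacterSpace.equivAlgHom.injective ?_
  refine character_ext_of_adjoin
    (s := (ADagger : Set (HΩ →L[ℂ] HΩ)) ∪ Set.range fun j : ℤ => mulOp (expT j))
    _ _ (map_continuous χ) (map_continuous ψ)
    (aDiamond_character_star χ) (aDiamond_character_star ψ) ?_
  rintro T (hT | ⟨j, rfl⟩)
  · have h3 := congrArg (fun χ : characterSpace ℂ ADagger => χ ⟨T, hT⟩) h2
    simp only [restrictDagger_apply] at h3
    exact h3
  · change χ (mulExp j) = ψ (mulExp j)
    rw [character_mulExp χ j, character_mulExp ψ j, h1]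

theorem diamondMap_surjective : Function.Surjective diamondMap := by
  rintro ⟨z, x, w⟩
  obtain ⟨θ, rfl⟩ := Circle.exp_surjective z
  -- The angle `θ` of `z` serves as the `t`-coordinate of the packets, where `e^{it}` takes the
  -- value `z`.
  obtain ⟨χ, hm, ht, hx⟩ := exists_character (θ, x) w
  refine ⟨χ, ?_⟩
  refine Prod.ext (Circle.ext ?_) (Prod.ext ?_ (Circle.ext ?_))
  · change χ (mulExp 1) = _
    refine (hm (expT 1) (mulExp 1).2).trans ?_
    simp [expT, mul_comm]
  · change basePoint (restrictDagger χ) = x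
    refine AddCircle.injective_toCircle Real.two_pi_pos.ne' (Circle.ext ?_)
    have h := fourier_basePoint (restrictDagger χ) 1
    rw [fourier_one] at h
    rw [h, restrictDagger_apply]
    refine (hm (liftX (fourier 1)) (toDiamond (unitX 1)).2).trans ?_
    simp [liftX]
  · refine Complex.ext ?_ ?_
    · change (restrictDagger χ genDt).re = _
      rw [restrictDagger_apply, ht, Complex.ofReal_re]
    · change (restrictDagger χ genDx).re = _
      rw [restrictDagger_apply, hx, Complex.ofReal_re]

theorem daggerMap_surjective : Function.Surjective daggerMap := fun p => by
  obtain ⟨χ, hχ⟩ := diamondMap_surjective (1, p)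
  exact ⟨restrictDagger χ, congrArg Prod.snd hχ⟩

theorem continuous_daggerMap : Continuous daggerMap :=
  continuous_basePoint.prodMk continuous_codirection

theorem continuous_diamondMap : Continuous diamondMap :=
  ((continuous_eval_aDiamond _).subtype_mk _).prodMk
    (continuous_daggerMap.comp restrictDagger.continuous)

/-- The symbol space of `𝒜†` is `𝕊¹ × S¹_∞`. -/
def daggerHomeomorph : SymbolSpace ADagger ≃ₜ S1 × Circle :=
  symbolSpaceHomeomorph.trans (IsHomeomorph.homeomorph daggerMap
    (isHomeomorph_iff_continuous_bijective.2
      ⟨continuous_daggerMap, daggerMap_injective, daggerMap_surjective⟩))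

/-- The symbol space of `𝒜◇` is `S¹ × 𝕊¹ × S¹_∞`. -/
def diamondHomeomorph : SymbolSpace ADiamond ≃ₜ Circle × S1 × Circle :=
  symbolSpaceHomeomorph.trans (IsHomeomorph.homeomorph diamondMap
    (isHomeomorph_iff_continuous_bijective.2
      ⟨continuous_diamondMap, diamondMap_injective, diamondMap_surjective⟩))

theorem daggerMap_daggerHomeomorph_symm (p : S1 × Circle) :
    daggerMap (symbolSpaceHomeomorph (daggerHomeomorph.symm p)) = p :=
  daggerHomeomorph.apply_symm_apply p

theorem diamondMap_diamondHomeomorph_symm (p : Circle × S1 × Circle) :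
    diamondMap (symbolSpaceHomeomorph (diamondHomeomorph.symm p)) = p :=
  diamondHomeomorph.apply_symm_apply p

end CylinderAlgebra

end

open CylinderAlgebra in
theorem mainTheorem12 :
    ∃ h : SymbolSpace ADagger ≃ₜ S1 × Circle,
      ((∀ (a : C(S1, ℂ)) (ha : SmoothS1 a) (x : S1) (w : Circle),
          symbol ADagger (mulX a ha) (h.symm (x, w)) = a x) ∧
        (∀ (x : S1) (w : Circle),
          symbol ADagger genΛ (h.symm (x, w)) = 0 ∧
          symbol ADagger genDt (h.symm (x, w)) = ((w : ℂ).re : ℂ) ∧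
          symbol ADagger genDx (h.symm (x, w)) = ((w : ℂ).im : ℂ))) ∧
      ∃ k : SymbolSpace ADiamond ≃ₜ Circle × S1 × Circle,
        (∀ (T : ADagger) (z : Circle) (x : S1) (w : Circle),
          symbol ADiamond (toDiamond T) (k.symm (z, x, w)) =
            symbol ADagger T (h.symm (x, w))) ∧
        (∀ (j : ℤ) (θ : ℝ) (x : S1) (w : Circle),
          symbol ADiamond (mulExp j) (k.symm (Circle.exp θ, x, w)) =
            Complex.exp (Complex.I * j * θ)) := by
  refine ⟨daggerHomeomorph, ⟨fun a ha x w => ?_, fun x w => ?_⟩, diamondHomeomorph,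
    fun T z x w => ?_, fun j θ x w => ?_⟩
  · have h := daggerMap_daggerHomeomorph_symm (x, w)
    rw [← symbolSpaceHomeomorph_apply, character_mulX]
    exact congrArg (fun p : S1 × Circle => a p.1) h
  · have h := daggerMap_daggerHomeomorph_symm (x, w)
    simp only [← symbolSpaceHomeomorph_apply]
    refine ⟨character_genΛ _, ?_, ?_⟩
    · rw [← character_genDt_re]
      exact congrArg (fun p : S1 × Circle => (((p.2 : ℂ).re : ℝ) : ℂ)) h
    · rw [← character_genDx_re]
      exact congrArg (fun p : S1 × Circle => (((p.2 : ℂ).im : ℝ) : ℂ)) h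
  · have h1 := daggerMap_daggerHomeomorph_symm (x, w)
    have h2 := congrArg Prod.snd (diamondMap_diamondHomeomorph_symm (z, x, w))
    -- The restricted character and the one from `h` have the same image under `daggerMap`, so they
    -- coincide.
    exact symbol_toDiamond (daggerMap_injective (h2.trans h1.symm)) T
  · have h := diamondMap_diamondHomeomorph_symm (Circle.exp θ, x, w)
    rw [← symbolSpaceHomeomorph_apply, character_mulExp]
    have h1 : symbolSpaceHomeomorph (diamondHomeomorph.symm (Circle.exp θ, x, w)) (mulExp 1) =
        (Circle.exp θ : ℂ) := congrArg (fun p : Circle × S1 × Circle => (p.1 : ℂ)) h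
    rw [h1, Circle.coe_exp, ← Complex.exp_int_mul]
    congr 1
    ring
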